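/- Let $C\ge 0$ and let $\ell_1,\dots,\ell_C$ be fixed positive integers (the job lengths). Then the following two decision problems are in $\mathrm{P}$, where all integers of the input are written in binary (and every machine is listed individually). 1. *High-multiplicity scheduling on uniform parallel machines.* Given $n_1,\dots,n_C\in\mathbb{Z}_{\ge 0}$, positive rational speeds $s_1,\dots,s_m$ of $m$ machines and a rational deadline $D\ge 0$ (rationals given as fractions of integers), do there exist nonnegative integers $x_{i,j}$ ($1\le i\le m$, $1\le j\le C$; the number of jobs of length $\ell_j$ scheduled on machine $i$) such that $\sum_{i=1}^m x_{i,j}=n_j$ for all $j$ and $\frac{1}{s_i}\sum_{j=1}^C \ell_j x_{i,j}\le D$ for all $i$? 2. *High-multiplicity scheduling with machine-dependent deadlines.* Given $n_1,\dots,n_C\in\mathbb{Z}_{\ge 0}$ and deadlines $D_1,\dots,D_m\in\mathbb{Z}_{\ge 0}$ of $m$ machines, do there exist nonnegative integers $x_{i,j}$ such that $\sum_{i=1}^m x_{i,j}=n_j$ for all $j$ and $\sum_{j=1}^C \ell_j x_{i,j}\le D_i$ for all $i$? -/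

import Mathlib

/-- The complexity class `P`: a language `L` over a finite alphabet is in `P` if some
deterministic (multi-stack) Turing machine, started on an arbitrary word `w` of the input
alphabet, halts with the truth value of `w ∈ L` as its output, after a number of steps that is
bounded by a fixed polynomial in the length of `w`. -/
def InP {Γ : Type} [Fintype Γ] (L : Language Γ) : Prop :=
  open Classical in
  Nonempty (Turing.TM2ComputableInPolyTime (id : List Γ → List Γ) Computability.encodeBool
    (fun w : List Γ => decide (w ∈ L)))

namespace HMScheduling

open Computability

/-- A finite list of natural numbers as a word: every number is written in binary
(canonically, without superfluous zeros) and followed by a comma. -/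
def encodeNumbers (L : List ℕ) : List Γ' :=
  L.flatMap fun n => encodingNatΓ'.encode n ++ [Γ'.comma]

/-- `x i j` is the number of jobs of type `j` that are processed on machine `i`. The assignment
is complete for the job counts `n` if exactly `n j` jobs of each type `j` are assigned. -/
def IsAssignment {C m : ℕ} (n : Fin C → ℕ) (x : Fin m → Fin C → ℕ) : Prop :=
  ∀ j, ∑ i, x i j = n j

/-- Total length of the jobs assigned to machine `i`, if a job of type `j` has length `ℓ j`. -/
def load {C m : ℕ} (ℓ : Fin C → ℕ) (x : Fin m → Fin C → ℕ) (i : Fin m) : ℕ :=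
  ∑ j, ℓ j * x i j

/-- An input of high-multiplicity scheduling with machine-dependent deadlines, for `C` (fixed)
job lengths: `count j` jobs of the `j`-th length, and `m` machines with deadlines. -/
structure DeadlineInstance (C : ℕ) where
  count : Fin C → ℕ
  m : ℕ
  deadline : Fin m → ℕ

/-- All jobs can be assigned to machines so that every machine meets its own deadline. -/
def DeadlineInstance.Schedulable {C : ℕ} (ℓ : Fin C → ℕ) (I : DeadlineInstance C) : Prop :=
  ∃ x : Fin I.m → Fin C → ℕ, IsAssignment I.count x ∧ ∀ i, load ℓ x i ≤ I.deadline i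

/-- The word `n₁, …, n_C, D₁, …, D_m`. -/
def DeadlineInstance.encode {C : ℕ} (I : DeadlineInstance C) : List Γ' :=
  encodeNumbers (List.ofFn I.count ++ List.ofFn I.deadline)

/-- The decision problem of high-multiplicity scheduling with machine-dependent deadlines, for
the fixed job lengths `ℓ`. -/
def deadlineScheduling {C : ℕ} (ℓ : Fin C → ℕ) : Language Γ' :=
  {w | ∃ I : DeadlineInstance C, I.encode = w ∧ I.Schedulable ℓ}

/-- An input of high-multiplicity scheduling on uniform parallel machines, for `C` (fixed)
job lengths: `count j` jobs of the `j`-th length, `m` machines with positive rational speeds,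
and one nonnegative rational deadline for all machines. The rational numbers are given as
fractions of natural numbers, which need not be in lowest terms. -/
structure UniformInstance (C : ℕ) where
  count : Fin C → ℕ
  m : ℕ
  speedNum : Fin m → ℕ
  speedDen : Fin m → ℕ
  speedNum_pos : ∀ i, 0 < speedNum i
  speedDen_pos : ∀ i, 0 < speedDen i
  deadlineNum : ℕ
  deadlineDen : ℕ
  deadlineDen_pos : 0 < deadlineDen

/-- The speed of machine `i`: the amount of job length processed per unit of time. -/
def UniformInstance.speed {C : ℕ} (I : UniformInstance C) (i : Fin I.m) : ℚ :=
  (I.speedNum i : ℚ) / (I.speedDen i : ℚ)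

/-- The common deadline. -/
def UniformInstance.deadline {C : ℕ} (I : UniformInstance C) : ℚ :=
  (I.deadlineNum : ℚ) / (I.deadlineDen : ℚ)

/-- All jobs can be assigned to machines so that every machine is finished by the common
deadline, where machine `i` needs time `length / speed i` to process its jobs. -/
def UniformInstance.Schedulable {C : ℕ} (ℓ : Fin C → ℕ) (I : UniformInstance C) : Prop :=
  ∃ x : Fin I.m → Fin C → ℕ, IsAssignment I.count x ∧
    ∀ i, (load ℓ x i : ℚ) / I.speed i ≤ I.deadline

/-- The word `n₁, …, n_C, a, b, p₁, q₁, …, p_m, q_m`, where `a / b` is the deadline and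
`pᵢ / qᵢ` is the speed of machine `i`. -/
def UniformInstance.encode {C : ℕ} (I : UniformInstance C) : List Γ' :=
  encodeNumbers (List.ofFn I.count ++ [I.deadlineNum, I.deadlineDen] ++
    (List.ofFn fun i => [I.speedNum i, I.speedDen i]).flatten)

/-- The decision problem of high-multiplicity scheduling on uniform parallel machines, for the
fixed job lengths `ℓ`. -/
def uniformScheduling {C : ℕ} (ℓ : Fin C → ℕ) : Language Γ' :=
  {w | ∃ I : UniformInstance C, I.encode = w ∧ I.Schedulable ℓ}

end HMScheduling

/-!
Both problems are solved by one program that computes with a bounded number of natural number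
registers and finally tests whether a vector of registers lies in a fixed finitely generated monoid.

*From scheduling to a monoid.* Let `P` be the product of the job lengths (`period`). Cut blocks of
length `P` off each deadline `D` as long as at least `C * P` remains (`residue`). If a machine has a
load of more than `C * P`, then some type of jobs contributes at least `P` to it, and since `P` is a
multiple of each job length, jobs of this type that fill exactly one block can be taken away. So a
schedule of a machine splits into a schedule for its residue and blocks that are empty or filled
with jobs of one type (`exists_split_blocks`). Blocks can be exchanged between machines, hence
schedulability only depends on the job counts, the sum of the deadlines and the number of machines
with each of the finitely many residues (`summary`), and it says that this vector of bounded
dimension is a sum of generators from a finite set (`fits_iff_summary_mem`). Uniform machines reduce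
to deadlines `⌊a * p / (b * q)⌋`, for the speed `p / q` and the common deadline `a / b`
(`div_speed_le_iff`).

*Membership in a finitely generated monoid.* If all coordinates of a vector are read in parallel in
binary, least significant digits first, then membership in a fixed finitely generated monoid can be
tested by a finite automaton: guess the binary digits of the coefficients of the generators along
the way; the carries stay bounded (`Realizable.of_mem_closure`). No integer programming in fixed
dimension is needed. Affine maps and comparisons can be carried out in the same way by finite
transducers (`Realizable.of_affine`, `Realizable.of_le`).

*The program.* `program` reads the input, computes the deadline of each machine by a division with
repeated doubling of the divisor, and adds up the vector above. The kind of a deadline is a function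
of its residue and thus compatible with addition (`kind_kind_add`), so that it can be kept in the
finite control during the division.

*The machine model.* A program whose operations are realized by finite transducers is executed by a
machine that keeps all registers in one storage word, one letter per binary place, and sweeps over
that word once for each operation (`inP_of_program`). Each sweep lengthens the word by a constant at
most, so a polynomial number of steps takes polynomial time on a stack machine that holds the two
sides of the scanning position on two stacks (`inP_of_sweep`).
-/

namespace HMScheduling

open Computability Turing

/-! ### Sweeping machines -/

/-- An operation of a sweeping machine. Such a machine has a finite control `Q`, an input that is
read symbol by symbol, and a storage word over a finite alphabet `A`. It can
* read the next input symbol (`none` at the end of the input) and choose the next control state,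
* rewrite the storage word from left to right by a sequential transducer with state space `St`;
  at the right end it appends the word `flush s` and moves on to the control state `exit s`,
  where `s` is the last state of the transducer,
* halt with a truth value. -/
inductive Op (A Q St : Type) : Type
  | read (f : Option Γ' → Q)
  | pass (init : St) (next : St → A → St) (out : St → A → A) (flush : St → List A) (exit : St → Q)
  | halt (b : Bool)

/-- The word written by a transducer, without the final flush. -/
def transduce {A St : Type} (next : St → A → St) (out : St → A → A) : St → List A → List A
  | _, [] => []
  | s, a :: u => out s a :: transduce next out (next s a) u

theorem length_transduce {A St : Type} (next : St → A → St) (out : St → A → A) (s : St)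
    (u : List A) : (transduce next out s u).length = u.length := by
  induction u generalizing s with
  | nil => rfl
  | cons a u ih => simp [transduce, ih]

/-- A configuration: control state, remaining input, storage (a word or, later on, registers). -/
structure Conf (Q D : Type) where
  state : Q
  input : List Γ'
  store : D

/-- One step of a sweeping machine; a halted machine stays where it is. -/
def sweepStep {A Q : Type} {St : Q → Type} (op : ∀ q, Op A Q (St q)) (c : Conf Q (List A)) :
    Conf Q (List A) :=
  match op c.state with
  | .read f => ⟨f c.input.head?, c.input.tail, c.store⟩
  | .pass i next out flush exit =>
    ⟨exit (c.store.foldl next i), c.input,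
      transduce next out i c.store ++ flush (c.store.foldl next i)⟩
  | .halt _ => c

theorem input_length_iterate {A Q : Type} {St : Q → Type} (op : ∀ q, Op A Q (St q))
    (c : Conf Q (List A)) (k : ℕ) :
    ((sweepStep op)^[k] c).input.length ≤ c.input.length := by
  induction k with
  | zero => simp
  | succ k ih =>
    rw [Function.iterate_succ_apply']
    refine le_trans ?_ ih
    generalize (sweepStep op)^[k] c = c
    unfold sweepStep
    split <;> simp

/-! ### Simulation of sweeping machines by stack machines -/

/-- The stacks: the input, the unread and the (reversed) rewritten part of the storage word, and
the output. -/
inductive Stack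
  | inp | fwd | bwd | out
  deriving DecidableEq

instance : Fintype Stack := ⟨{.inp, .fwd, .bwd, .out}, by rintro (_ | _ | _ | _) <;> simp⟩

/-- The stack alphabets. -/
abbrev Sym (A : Type) : Stack → Type
  | .inp => Γ'
  | .fwd => A
  | .bwd => A
  | .out => Bool

/-- The labels of the stack machine: `run q` starts the operation of `q`, `scan q s` is a
transducer in state `s`, `back q` moves the rewritten word back and continues with `q`, and
`clear b` empties all stacks and outputs `b`. -/
inductive Lab (Q : Type) (St : Q → Type)
  | run (q : Q)
  | scan (q : Q) (s : St q)
  | back (q : Q)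
  | clear (b : Bool)

noncomputable instance {Q : Type} {St : Q → Type} [Fintype Q] [∀ q, Fintype (St q)] :
    Fintype (Lab Q St) :=
  Fintype.ofInjective
    (fun l : Lab Q St => (match l with
      | .run q => .inl q
      | .scan q s => .inr (.inl ⟨q, s⟩)
      | .back q => .inr (.inr (.inl q))
      | .clear b => .inr (.inr (.inr b)) : Q ⊕ (Σ q, St q) ⊕ Q ⊕ Bool))
    (by rintro (_ | _ | _ | _) (_ | _ | _ | _) h <;> simp_all)

/-- The local variables: the symbol read last from the input, and from the storage. -/
abbrev Loc (A : Type) : Type := Option Γ' × Option A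

/-- Statements of the stack machine. -/
abbrev SStmt (A Q : Type) (St : Q → Type) : Type := TM2.Stmt (Sym A) (Lab Q St) (Loc A)

/-- Push the letters of a fixed word onto the stack `bwd`, one by one. -/
def pushAll {A Q : Type} {St : Q → Type} : List A → SStmt A Q St → SStmt A Q St
  | [], s => s
  | a :: l, s => .push .bwd (fun _ => a) (pushAll l s)

open TM2.Stmt in
/-- The stack machine that simulates a sweeping machine. -/
def stmts {A Q : Type} [Inhabited A] {St : Q → Type} (op : ∀ q, Op A Q (St q)) :
    Lab Q St → SStmt A Q St
  | .run q =>
    match op q with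
    | .read f => pop .inp (fun _ x => (x, none)) (goto fun v => .run (f v.1))
    | .pass i _ _ _ _ => goto fun _ => .scan q i
    | .halt b => goto fun _ => .clear b
  | .scan q s =>
    match op q with
    | .pass _ next out flush exit =>
      pop .fwd (fun _ x => (none, x)) (branch (fun v => v.2.isSome)
        (push .bwd (fun v => out s (v.2.getD default))
          (goto fun v => .scan q (next s (v.2.getD default))))
        (pushAll (flush s) (goto fun _ => .back (exit s))))
    | _ => TM2.Stmt.halt
  | .back q =>
    pop .bwd (fun _ x => (none, x)) (branch (fun v => v.2.isSome)
      (push .fwd (fun v => v.2.getD default) (goto fun _ => .back q))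
      (goto fun _ => .run q))
  | .clear b =>
    pop .fwd (fun _ x => (none, x)) (branch (fun v => v.2.isSome)
      (goto fun _ => .clear b)
      (pop .inp (fun _ x => (x, none)) (branch (fun v => v.1.isSome)
        (goto fun _ => .clear b)
        (push .out (fun _ => b) (TM2.Stmt.load (fun _ => (none, none)) TM2.Stmt.halt)))))

/-- The contents of all stacks. -/
def stks {A : Type} (w : List Γ') (u y : List A) (o : List Bool) : ∀ k, List (Sym A k)
  | .inp => w
  | .fwd => u
  | .bwd => y
  | .out => o

section StackOperations

variable {A Q : Type} {St : Q → Type} (q : SStmt A Q St) (v : Loc A) (w : List Γ') (u y : List A)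
  (o : List Bool)

theorem stepAux_pop_inp (f : Loc A → Option Γ' → Loc A) :
    TM2.stepAux (.pop .inp f q) v (stks w u y o) =
      TM2.stepAux q (f v w.head?) (stks w.tail u y o) :=
  congrArg (TM2.stepAux q _) (funext fun k => by cases k <;> rfl)

theorem stepAux_pop_fwd (f : Loc A → Option A → Loc A) :
    TM2.stepAux (.pop .fwd f q) v (stks w u y o) =
      TM2.stepAux q (f v u.head?) (stks w u.tail y o) :=
  congrArg (TM2.stepAux q _) (funext fun k => by cases k <;> rfl)

theorem stepAux_pop_bwd (f : Loc A → Option A → Loc A) :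
    TM2.stepAux (.pop .bwd f q) v (stks w u y o) =
      TM2.stepAux q (f v y.head?) (stks w u y.tail o) :=
  congrArg (TM2.stepAux q _) (funext fun k => by cases k <;> rfl)

theorem stepAux_push_fwd (f : Loc A → A) :
    TM2.stepAux (.push .fwd f q) v (stks w u y o) = TM2.stepAux q v (stks w (f v :: u) y o) :=
  congrArg (TM2.stepAux q _) (funext fun k => by cases k <;> rfl)

theorem stepAux_push_bwd (f : Loc A → A) :
    TM2.stepAux (.push .bwd f q) v (stks w u y o) = TM2.stepAux q v (stks w u (f v :: y) o) :=
  congrArg (TM2.stepAux q _) (funext fun k => by cases k <;> rfl)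

theorem stepAux_push_out (f : Loc A → Bool) :
    TM2.stepAux (.push .out f q) v (stks w u y o) = TM2.stepAux q v (stks w u y (f v :: o)) :=
  congrArg (TM2.stepAux q _) (funext fun k => by cases k <;> rfl)

theorem stepAux_branch (f : Loc A → Bool) (q' : SStmt A Q St) (S : ∀ k, List (Sym A k)) :
    TM2.stepAux (.branch f q q') v S = cond (f v) (TM2.stepAux q v S) (TM2.stepAux q' v S) :=
  rfl

theorem stepAux_pushAll (l : List A) :
    TM2.stepAux (pushAll l q) v (stks w u y o) =
      TM2.stepAux q v (stks w u (l.reverse ++ y) o) := by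
  induction l generalizing y with
  | nil => rfl
  | cons a l ih =>
    rw [pushAll, stepAux_push_bwd, ih]
    simp

end StackOperations

/-- The partial function `f` leads from `a` to `b` in at most `t` steps. -/
def LeadsTo {α : Type} (f : α → Option α) (t : ℕ) (a b : α) : Prop :=
  ∃ k ≤ t, (flip bind f)^[k] (some a) = some b

namespace LeadsTo

variable {α : Type} {f : α → Option α} {s t : ℕ} {a b c : α}

theorem refl : LeadsTo f 0 a a := ⟨0, le_rfl, rfl⟩

theorem single (h : f a = some b) : LeadsTo f 1 a b := ⟨1, le_rfl, h⟩

theorem trans (h₁ : LeadsTo f s a b) (h₂ : LeadsTo f t b c) : LeadsTo f (s + t) a c := by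
  obtain ⟨k, hk, h⟩ := h₁
  obtain ⟨l, hl, h'⟩ := h₂
  exact ⟨l + k, by omega, by rw [Function.iterate_add_apply, h, h']⟩

theorem mono (h : LeadsTo f s a b) (hst : s ≤ t) : LeadsTo f t a b :=
  let ⟨k, hk, h⟩ := h
  ⟨k, hk.trans hst, h⟩

end LeadsTo

section Simulation

variable {A Q : Type} [Inhabited A] {St : Q → Type} (op : ∀ q, Op A Q (St q))

theorem step_leadsTo {l : Lab Q St} {v : Loc A} {S : ∀ k, List (Sym A k)}
    {c : TM2.Cfg (Sym A) (Lab Q St) (Loc A)} (h : TM2.stepAux (stmts op l) v S = c) :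
    LeadsTo (TM2.step (stmts op)) 1 ⟨some l, v, S⟩ c :=
  LeadsTo.single (congrArg some h)

theorem scan_leadsTo {q : Q} {i : St q} {next : St q → A → St q} {out : St q → A → A}
    {flush : St q → List A} {exit : St q → Q} (hq : op q = .pass i next out flush exit)
    (s : St q) (v : Loc A) (w : List Γ') (u y : List A) :
    LeadsTo (TM2.step (stmts op)) (u.length + 1) ⟨some (.scan q s), v, stks w u y []⟩
      ⟨some (.back (exit (u.foldl next s))), (none, none),
        stks w [] ((transduce next out s u ++ flush (u.foldl next s)).reverse ++ y) []⟩ := by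
  induction u generalizing s v y with
  | nil =>
    refine step_leadsTo op ?_
    simp only [stmts, hq]
    rw [stepAux_pop_fwd, stepAux_branch]
    refine (stepAux_pushAll _ _ _ _ _ _ _).trans ?_
    simp [transduce]
  | cons a u ih =>
    have h : LeadsTo (TM2.step (stmts op)) 1 ⟨some (.scan q s), v, stks w (a :: u) y []⟩
        ⟨some (.scan q (next s a)), (none, some a), stks w u (out s a :: y) []⟩ := by
      refine step_leadsTo op ?_
      simp only [stmts, hq]
      rw [stepAux_pop_fwd, stepAux_branch]
      simp only [List.head?_cons, Option.isSome_some, cond_true]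
      exact stepAux_push_bwd _ _ _ _ _ _ _
    have h' := h.trans (ih (next s a) (none, some a) (out s a :: y))
    rw [add_comm] at h'
    simpa [transduce] using h'

theorem back_leadsTo (q : Q) (v : Loc A) (w : List Γ') (u y : List A) :
    LeadsTo (TM2.step (stmts op)) (y.length + 1) ⟨some (.back q), v, stks w u y []⟩
      ⟨some (.run q), (none, none), stks w (y.reverse ++ u) [] []⟩ := by
  induction y generalizing v u with
  | nil =>
    refine step_leadsTo op ?_
    simp only [stmts]
    rw [stepAux_pop_bwd, stepAux_branch]
    rfl
  | cons a y ih =>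
    have h : LeadsTo (TM2.step (stmts op)) 1 ⟨some (.back q), v, stks w u (a :: y) []⟩
        ⟨some (.back q), (none, some a), stks w (a :: u) y []⟩ := by
      refine step_leadsTo op ?_
      simp only [stmts]
      rw [stepAux_pop_bwd, stepAux_branch]
      simp only [List.head?_cons, Option.isSome_some, cond_true]
      exact stepAux_push_fwd _ _ _ _ _ _ _
    have h' := h.trans (ih (none, some a) (a :: u))
    rw [add_comm] at h'
    simpa using h'

theorem clear_leadsTo (b : Bool) (v : Loc A) (w : List Γ') (u : List A) :
    LeadsTo (TM2.step (stmts op)) (u.length + w.length + 1)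
      ⟨some (.clear b), v, stks w u [] []⟩ ⟨none, (none, none), stks [] [] [] [b]⟩ := by
  induction u generalizing v with
  | nil =>
    induction w generalizing v with
    | nil =>
      refine step_leadsTo op ?_
      simp only [stmts]
      rw [stepAux_pop_fwd, stepAux_branch]
      simp only [List.head?_nil, Option.isSome_none, cond_false]
      refine (stepAux_pop_inp _ _ _ _ _ _ _).trans ?_
      rw [stepAux_branch]
      simp only [List.head?_nil, Option.isSome_none, cond_false]
      exact stepAux_push_out _ _ _ _ _ _ _
    | cons a w ih =>
      refine ((step_leadsTo op ?_).trans (ih (some a, none))).mono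
        (by simp; omega)
      simp only [stmts]
      rw [stepAux_pop_fwd, stepAux_branch]
      simp only [List.head?_nil, Option.isSome_none, cond_false]
      exact stepAux_pop_inp _ _ _ _ _ _ _
  | cons a u ih =>
    refine ((step_leadsTo op ?_).trans (ih (none, some a))).mono (by simp; omega)
    simp only [stmts]
    rw [stepAux_pop_fwd, stepAux_branch]
    rfl

/-- A step of a sweeping machine costs time linear in the length of the storage word. -/
theorem run_leadsTo (c : Conf Q (List A)) (v : Loc A) :
    ∃ v', LeadsTo (TM2.step (stmts op)) (c.store.length + (sweepStep op c).store.length + 3)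
      ⟨some (.run c.state), v, stks c.input c.store [] []⟩
      ⟨some (.run (sweepStep op c).state), v',
        stks (sweepStep op c).input (sweepStep op c).store [] []⟩ := by
  obtain ⟨q, w, u⟩ := c
  cases hq : op q with
  | read f =>
    refine ⟨(w.head?, none), (step_leadsTo op ?_).mono (by omega)⟩
    simp only [stmts, hq, sweepStep]
    exact stepAux_pop_inp _ _ _ _ _ _ _
  | halt b =>
    refine ⟨v, ?_⟩
    simp only [sweepStep, hq]
    exact LeadsTo.refl.mono (by omega)
  | pass i next out flush exit =>
    refine ⟨(none, none), ?_⟩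
    have h₀ : LeadsTo (TM2.step (stmts op)) 1 ⟨some (.run q), v, stks w u [] []⟩
        ⟨some (.scan q i), v, stks w u [] []⟩ := by
      refine step_leadsTo op ?_
      simp only [stmts, hq]
      rfl
    have h₁ := scan_leadsTo op hq i v w u []
    have h₂ := back_leadsTo op (exit (u.foldl next i)) (none, none) w []
      ((transduce next out i u ++ flush (u.foldl next i)).reverse)
    rw [List.append_nil] at h₁
    have h := (h₀.trans h₁).trans h₂
    rw [List.reverse_reverse, List.append_nil, List.length_reverse] at h
    simp only [sweepStep, hq]
    exact h.mono (by omega)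

/-- If every step lengthens the storage word by at most `N`, then `k` steps of a sweeping machine,
started with the empty storage word, take time quadratic in `k`. -/
theorem iterate_leadsTo (N : ℕ)
    (hN : ∀ c, (sweepStep op c).store.length ≤ c.store.length + N) (c : Conf Q (List A))
    (v : Loc A) (hc : c.store = []) (k : ℕ) :
    ((sweepStep op)^[k] c).store.length ≤ N * k ∧
    ∃ v', LeadsTo (TM2.step (stmts op)) (k * (2 * N * k + N + 3))
      ⟨some (.run c.state), v, stks c.input c.store [] []⟩
      ⟨some (.run ((sweepStep op)^[k] c).state), v',
        stks ((sweepStep op)^[k] c).input ((sweepStep op)^[k] c).store [] []⟩ := by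
  induction k with
  | zero => exact ⟨by simp [hc], v, LeadsTo.refl.mono (by omega)⟩
  | succ k ih =>
    obtain ⟨hl, v₁, h₁⟩ := ih
    rw [Function.iterate_succ_apply']
    have hs := hN ((sweepStep op)^[k] c)
    obtain ⟨v₂, h₂⟩ := run_leadsTo op ((sweepStep op)^[k] c) v₁
    refine ⟨by rw [mul_add]; omega, v₂, (h₁.trans h₂).mono ?_⟩
    nlinarith

/-- A sweeping machine that has decided its input `w` after `k` steps yields a run of the stack
machine that ends with the answer on the output stack and all other stacks empty. -/
theorem decides_leadsTo (q₀ : Q) (N : ℕ)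
    (hN : ∀ c, (sweepStep op c).store.length ≤ c.store.length + N) (w : List Γ') (k : ℕ)
    (b : Bool) (h : op ((sweepStep op)^[k] ⟨q₀, w, []⟩).state = .halt b) :
    LeadsTo (TM2.step (stmts op)) (k * (2 * N * k + N + 3) + N * k + w.length + 2)
      ⟨some (.run q₀), (none, none), stks w [] [] []⟩
      ⟨none, (none, none), stks [] [] [] [b]⟩ := by
  obtain ⟨hlen, v', hrun⟩ := iterate_leadsTo op N hN ⟨q₀, w, []⟩ (none, none) rfl k
  have hinp := input_length_iterate op ⟨q₀, w, []⟩ k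
  set c := (sweepStep op)^[k] ⟨q₀, w, []⟩
  have hclr : LeadsTo (TM2.step (stmts op)) 1
      ⟨some (.run c.state), v', stks c.input c.store [] []⟩
      ⟨some (.clear b), v', stks c.input c.store [] []⟩ := by
    refine step_leadsTo op ?_
    simp only [stmts, h]
    rfl
  refine ((hrun.trans hclr).trans (clear_leadsTo op b v' c.input c.store)).mono ?_
  have : c.input.length ≤ w.length := hinp
  omega

/-- A language that is decided by a sweeping machine in polynomially many steps is in `P`. -/
theorem inP_of_sweep [Fintype A] [Fintype Q] [∀ q, Fintype (St q)] (q₀ : Q) (N : ℕ)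
    (hN : ∀ c, (sweepStep op c).store.length ≤ c.store.length + N) (L : Language Γ')
    (time : Polynomial ℕ)
    (h : ∀ w, ∃ k ≤ time.eval w.length, ∃ b : Bool, (b = true ↔ w ∈ L) ∧
      op ((sweepStep op)^[k] ⟨q₀, w, []⟩).state = .halt b) : InP L := by
  classical
  have hrun : ∀ w, LeadsTo (TM2.step (stmts op))
      ((time * (Polynomial.C (2 * N) * time + Polynomial.C (N + 3)) + Polynomial.C N * time +
        Polynomial.X + 2).eval w.length)
      ⟨some (.run q₀), (none, none), stks w [] [] []⟩
      ⟨none, (none, none), stks [] [] [] [decide (w ∈ L)]⟩ := by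
    intro w
    obtain ⟨k, hk, b, hb, hop⟩ := h w
    have hbw : decide (w ∈ L) = b := by
      by_cases hw : w ∈ L <;> simp_all
    rw [hbw]
    refine (decides_leadsTo op q₀ N hN w k b hop).mono ?_
    simp only [Polynomial.eval_add, Polynomial.eval_mul, Polynomial.eval_C, Polynomial.eval_X,
      Polynomial.eval_ofNat]
    generalize Polynomial.eval w.length time = T at hk ⊢
    rw [add_assoc (2 * N * k)]
    gcongr
  choose n hn hrun using hrun
  refine ⟨{
    tm := {
      K := Stack
      k₀ := .inp
      k₁ := .out
      Γ := Sym A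
      Λ := Lab Q St
      main := .run q₀
      σ := Option Γ' × Option A
      initialState := (none, none)
      Γk₀Fin := inferInstanceAs (Fintype Γ')
      m := stmts op }
    inputAlphabet := Equiv.refl _
    outputAlphabet := Equiv.refl _
    time := time * (Polynomial.C (2 * N) * time + Polynomial.C (N + 3)) + Polynomial.C N * time +
      Polynomial.X + 2
    outputsFun := fun w => ⟨⟨n w, ?_⟩, hn w⟩ }⟩
  refine Eq.trans (congrArg _ (congrArg some ?_)) ((hrun w).trans (congrArg some ?_))
  · unfold initList
    congr 1
    funext k
    cases k <;> simp [stks]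
  · unfold haltList
    congr 1
    funext k
    cases k <;> simp [stks, encodeBool]

end Simulation

/-! ### Register programs -/

/-- An instruction of a program with natural number registers `ι` and control states `Q`: read the
next input symbol and branch, update the registers and branch according to a function `g` of the
register contents, or halt with a truth value. -/
inductive Instr (ι Q : Type) : Type
  | read (f : Option Γ' → Q)
  | upd (g : (ι → ℕ) → (ι → ℕ) × Q)
  | halt (b : Bool)

/-- One step of a register program. -/
def progStep {ι Q : Type} (P : Q → Instr ι Q) (c : Conf Q (ι → ℕ)) : Conf Q (ι → ℕ) :=
  match P c.state with
  | .read f => ⟨f c.input.head?, c.input.tail, c.store⟩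
  | .upd g => ⟨(g c.store).2, c.input, (g c.store).1⟩
  | .halt _ => c

/-- The register contents that are represented by a storage word over the alphabet `ι → Bool`. The
letters of the word consist of the binary digits of the same place of all registers, and the
least significant digits come first. -/
def val {ι : Type} : List (ι → Bool) → ι → ℕ
  | [], _ => 0
  | a :: u, i => (a i).toNat + 2 * val u i

/-- A sequential transducer on storage words carries out the register operation `g`. -/
def Realizable {ι Q : Type} (g : (ι → ℕ) → (ι → ℕ) × Q) : Prop :=
  ∃ (St : Type) (_ : Finite St) (init : St) (next : St → (ι → Bool) → St)
    (out : St → (ι → Bool) → ι → Bool) (flush : St → List (ι → Bool)) (exit : St → Q),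
    ∀ u, val (transduce next out init u ++ flush (u.foldl next init)) = (g (val u)).1 ∧
      exit (u.foldl next init) = (g (val u)).2

/-- A language that is decided by a program with realizable operations in polynomially many steps
is in `P`. -/
theorem inP_of_program {ι Q : Type} [Fintype ι] [Fintype Q] (P : Q → Instr ι Q)
    (hP : ∀ q g, P q = .upd g → Realizable g) (q₀ : Q) (L : Language Γ')
    (time : Polynomial ℕ)
    (h : ∀ w, ∃ k ≤ time.eval w.length, ∃ b : Bool, (b = true ↔ w ∈ L) ∧
      P ((progStep P)^[k] ⟨q₀, w, 0⟩).state = .halt b) : InP L := by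
  classical
  have hop : ∀ q, ∃ (St : Type) (_ : Finite St) (op : Op (ι → Bool) Q St),
      (∃ N, ∀ i next out flush exit, op = .pass i next out flush exit →
        ∀ s, (flush s).length ≤ N) ∧
      match P q with
      | .read f => op = .read f
      | .halt b => op = .halt b
      | .upd g => ∃ i next out flush exit, op = .pass i next out flush exit ∧
          ∀ u, val (transduce next out i u ++ flush (u.foldl next i)) = (g (val u)).1 ∧
            exit (u.foldl next i) = (g (val u)).2 := by
    intro q
    cases hq : P q with
    | read f => exact ⟨Unit, inferInstance, .read f, ⟨0, by simp⟩, rfl⟩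
    | halt b => exact ⟨Unit, inferInstance, .halt b, ⟨0, by simp⟩, rfl⟩
    | upd g =>
      obtain ⟨St, hSt, i, next, out, flush, exit, hg⟩ := hP q g hq
      have := Fintype.ofFinite St
      refine ⟨St, hSt, .pass i next out flush exit,
        ⟨Finset.univ.sup fun s => (flush s).length, ?_⟩, i, next, out, flush, exit, rfl, hg⟩
      rintro _ _ _ _ _ h s
      cases h
      exact Finset.le_sup (f := fun s => (flush s).length) (Finset.mem_univ s)
  choose St hSt op hN hop using hop
  choose N hN using hN
  have := fun q => Fintype.ofFinite (St q)
  have hlen : ∀ c, (sweepStep op c).store.length ≤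
      c.store.length + Finset.univ.sup N := by
    intro c
    unfold sweepStep
    cases hc : op c.state with
    | read f => simp
    | halt b => simp
    | pass i next out flush exit =>
      simp only [List.length_append, length_transduce]
      have := hN c.state _ _ _ _ _ hc (c.store.foldl next i)
      have := Finset.le_sup (f := N) (Finset.mem_univ c.state)
      omega
  have hsim : ∀ (w : List Γ') (k : ℕ), (progStep P)^[k] ⟨q₀, w, 0⟩ =
      (fun c : Conf Q (List (ι → Bool)) => (⟨c.state, c.input, val c.store⟩ : Conf Q (ι → ℕ)))
        ((sweepStep op)^[k] ⟨q₀, w, []⟩) := by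
    intro w k
    induction k with
    | zero => rfl
    | succ k ih =>
      rw [Function.iterate_succ_apply', ih, Function.iterate_succ_apply']
      generalize (sweepStep op)^[k] ⟨q₀, w, []⟩ = c
      have hc := hop c.state
      unfold progStep sweepStep
      cases hq : P c.state with
      | read f => simp only [hq] at hc; simp [hc]
      | halt b => simp only [hq] at hc; simp [hc]
      | upd g =>
        simp only [hq] at hc
        obtain ⟨i, next, out, flush, exit, ho, hg⟩ := hc
        simp [ho, hg c.store]
  refine inP_of_sweep op q₀ _ hlen L time fun w => ?_
  obtain ⟨k, hk, b, hb, hh⟩ := h w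
  refine ⟨k, hk, b, hb, ?_⟩
  rw [hsim] at hh
  have := hop ((sweepStep op)^[k] ⟨q₀, w, []⟩).state
  simpa only [hh] using this

/-! ### Realizable operations -/

/-- Transducers whose reachable states lie in a finite set. -/
theorem Realizable.of_invariant {ι Q St : Type} {g : (ι → ℕ) → (ι → ℕ) × Q} (I : Set St)
    (hI : I.Finite) {init : St} (hinit : init ∈ I) {next : St → (ι → Bool) → St}
    (hnext : ∀ s ∈ I, ∀ a, next s a ∈ I) (out : St → (ι → Bool) → ι → Bool)
    (flush : St → List (ι → Bool)) (exit : St → Q)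
    (h : ∀ u, val (transduce next out init u ++ flush (u.foldl next init)) = (g (val u)).1 ∧
      exit (u.foldl next init) = (g (val u)).2) : Realizable g := by
  have key : ∀ (u : List (ι → Bool)) (s : I),
      ((u.foldl (fun (s : I) a => (⟨next s a, hnext s s.2 a⟩ : I)) s : I) : St) =
        u.foldl next s ∧
      transduce (fun (s : I) a => (⟨next s a, hnext s s.2 a⟩ : I)) (fun s a => out s a) s u =
        transduce next out s u := by
    intro u
    induction u with
    | nil => exact fun s => ⟨rfl, rfl⟩
    | cons a u ih =>
      exact fun s => ⟨(ih _).1, congrArg (out s a :: ·) (ih ⟨next s a, hnext s s.2 a⟩).2⟩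
  refine ⟨I, hI, ⟨init, hinit⟩, fun s a => ⟨next s a, hnext s s.2 a⟩, fun s a => out s a,
    fun s => flush s, fun s => exit s, fun u => ?_⟩
  simp only [(key u _).1, (key u _).2]
  exact h u

theorem transduce_id {A St : Type} (next : St → A → St) (s : St) (u : List A) :
    transduce next (fun _ a => a) s u = u := by
  induction u generalizing s with
  | nil => rfl
  | cons a u ih => rw [transduce, ih]

/-- Tests that leave the registers unchanged. -/
theorem Realizable.of_test {ι Q St : Type} {g : (ι → ℕ) → Q} (I : Set St)
    (hI : I.Finite) {init : St} (hinit : init ∈ I) {next : St → (ι → Bool) → St}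
    (hnext : ∀ s ∈ I, ∀ a, next s a ∈ I) (exit : St → Q)
    (h : ∀ u, exit (u.foldl next init) = g (val u)) : Realizable fun v => (v, g v) :=
  .of_invariant I hI hinit hnext (fun _ a => a) (fun _ => []) exit fun u =>
    ⟨by rw [transduce_id, List.append_nil], h u⟩

/-- A function of the registers of the form `v ↦ ∑ mᵢ vᵢ + c` with natural coefficients. -/
def IsAffine {ι : Type} [Fintype ι] (f : (ι → ℕ) → ℕ) : Prop :=
  ∃ (m : ι → ℕ) (c : ℕ), ∀ v, f v = ∑ i, m i * v i + c

namespace IsAffine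

variable {ι : Type} [Fintype ι] {f f' : (ι → ℕ) → ℕ}

theorem const (c : ℕ) : IsAffine fun _ : ι → ℕ => c := ⟨0, c, by simp⟩

theorem proj (i : ι) : IsAffine fun v : ι → ℕ => v i := by
  classical
  exact ⟨Pi.single i 1, 0, fun v => by simp [Pi.single_apply]⟩

theorem add (hf : IsAffine f) (hf' : IsAffine f') : IsAffine fun v => f v + f' v := by
  obtain ⟨m, c, h⟩ := hf
  obtain ⟨m', c', h'⟩ := hf'
  refine ⟨m + m', c + c', fun v => ?_⟩
  simp only [h, h', Pi.add_apply, add_mul, Finset.sum_add_distrib]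
  ring

theorem const_mul (k : ℕ) (hf : IsAffine f) : IsAffine fun v => k * f v := by
  obtain ⟨m, c, h⟩ := hf
  refine ⟨k • m, k * c, fun v => ?_⟩
  simp only [h, Pi.smul_apply, smul_eq_mul, mul_add, Finset.mul_sum, mul_assoc]

end IsAffine

/-- The digits of the `k` lowest places of a vector of natural numbers. -/
def digits {ι : Type} : ℕ → (ι → ℕ) → List (ι → Bool)
  | 0, _ => []
  | k + 1, c => (fun i => c i % 2 == 1) :: digits k fun i => c i / 2

theorem toNat_mod_two (n : ℕ) : (n % 2 == 1).toNat = n % 2 := by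
  rcases Nat.mod_two_eq_zero_or_one n with h | h <;> simp [h]

theorem val_digits {ι : Type} (k : ℕ) (c : ι → ℕ) (hc : ∀ i, c i < 2 ^ k) :
    val (digits k c) = c := by
  induction k generalizing c with
  | zero => funext i; have := hc i; simp [val, digits]; omega
  | succ k ih =>
    have h := ih (fun i => c i / 2) fun i => by
      have := hc i
      rw [pow_succ] at this
      omega
    funext i
    rw [digits, val, toNat_mod_two, h]
    exact Nat.mod_add_div _ _

/-- Assignments of affine functions are realizable: the transducer remembers the carries. -/
theorem Realizable.of_affine {ι Q : Type} [Fintype ι] {g : (ι → ℕ) → ι → ℕ}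
    (hg : ∀ i, IsAffine fun v => g v i) (q : Q) : Realizable fun v => (g v, q) := by
  choose m c hg using hg
  -- all carries stay below this bound
  set N := ∑ i, ∑ j, m i j + ∑ i, c i with hN
  have hm : ∀ i, ∑ j, m i j + c i ≤ N := fun i => add_le_add
    (Finset.single_le_sum (f := fun i => ∑ j, m i j) (fun _ _ => Nat.zero_le _)
      (Finset.mem_univ i))
    (Finset.single_le_sum (f := c) (fun _ _ => Nat.zero_le _) (Finset.mem_univ i))
  set S : (ι → ℕ) → (ι → Bool) → ι → ℕ := fun s a i => ∑ j, m i j * (a j).toNat + s i with hS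
  have hSm : ∀ s a i, S s a i ≤ ∑ j, m i j + s i := fun s a i => by
    refine Nat.add_le_add_right (Finset.sum_le_sum fun j _ => ?_) _
    cases a j <;> simp
  refine .of_invariant (St := ι → ℕ) {s | ∀ i, s i ≤ N} ?_ (init := c) ?_
    (next := fun s a i => S s a i / 2) ?_ (fun s a i => S s a i % 2 == 1) (digits N)
    (fun _ => q) fun u => ⟨?_, rfl⟩
  · exact Set.Finite.pi' fun _ => Set.finite_Iic N
  · exact fun i => le_trans (by omega) (hm i)
  · intro s hs a i
    have h₁ := hSm s a i
    have h₂ := hm i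
    have h₃ := hs i
    change S s a i / 2 ≤ N
    omega
  · have key : ∀ (u : List (ι → Bool)) (s : ι → ℕ), (∀ i, s i ≤ N) →
        val (transduce (fun s a i => S s a i / 2) (fun s a i => S s a i % 2 == 1) s u ++
          digits N (u.foldl (fun s a i => S s a i / 2) s)) =
        fun i => ∑ j, m i j * val u j + s i := by
      intro u
      induction u with
      | nil =>
        intro s hs
        simp only [transduce, List.nil_append, List.foldl_nil]
        rw [val_digits N s fun i => (hs i).trans_lt Nat.lt_two_pow_self]
        simp [val]
      | cons a u ih =>
        intro s hs
        rw [transduce, List.foldl_cons, List.cons_append]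
        funext i
        rw [val, ih _ fun i => ?_, toNat_mod_two]
        · simp only [val, mul_add, Finset.sum_add_distrib]
          have : ∑ j, m i j * (2 * val u j) = 2 * ∑ j, m i j * val u j := by
            rw [Finset.mul_sum]
            exact Finset.sum_congr rfl fun j _ => by ring
          simp only [this, hS]
          omega
        · have h₁ := hSm s a i
          have h₂ := hm i
          have h₃ := hs i
          omega
    rw [key u c fun i => le_trans (by omega) (hm i)]
    exact (funext fun i => hg i (val u)).symm

/-- Comparisons of affine functions are realizable: the transducer remembers the carry of the
difference, whose sign at the end is the sign of the difference. -/
theorem Realizable.of_le {ι Q : Type} [Fintype ι] {f f' : (ι → ℕ) → ℕ} (hf : IsAffine f)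
    (hf' : IsAffine f') (q q' : Q) : Realizable fun v => (v, if f v ≤ f' v then q else q') := by
  obtain ⟨m, c, hf⟩ := hf
  obtain ⟨m', c', hf'⟩ := hf'
  set d : ι → ℤ := fun i => m' i - m i with hd
  set e : ℤ := c' - c with he
  set N : ℤ := ∑ i, |d i| + |e| with hN
  set S : ℤ → (ι → Bool) → ℤ := fun s a => ∑ i, d i * (a i).toNat + s with hS
  have hSm : ∀ s a, |S s a| ≤ N + |s| := fun s a => by
    refine (abs_add_le _ _).trans (Int.add_le_add_right ?_ _)
    refine (Finset.abs_sum_le_sum_abs _ _).trans (le_trans (Finset.sum_le_sum fun i _ => ?_)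
      (le_add_of_nonneg_right (abs_nonneg e)))
    cases a i <;> simp
  have h0 : |e| ≤ N := le_add_of_nonneg_left (Finset.sum_nonneg fun i _ => abs_nonneg _)
  refine .of_test (St := ℤ) (Set.Icc (-N) N) (Set.finite_Icc _ _) (init := e)
    (abs_le.1 h0) (next := fun s a => S s a / 2) ?_ (fun s => if 0 ≤ s then q else q') ?_
  · intro s hs a
    have h₁ := abs_le.1 (hSm s a)
    have h₂ := abs_le.2 hs
    rw [Set.mem_Icc]
    omega
  · have key : ∀ (u : List (ι → Bool)) (s : ℤ),
        0 ≤ u.foldl (fun s a => S s a / 2) s ↔ 0 ≤ ∑ i, d i * val u i + s := by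
      intro u
      induction u with
      | nil => simp [val]
      | cons a u ih =>
        intro s
        rw [List.foldl_cons, ih]
        have : ∑ i, d i * (val (a :: u) i : ℕ) + s = S s a + 2 * ∑ i, d i * val u i := by
          simp only [val, hS, Finset.mul_sum]
          push_cast
          simp only [mul_add, Finset.sum_add_distrib]
          have : ∀ i, d i * (2 * (val u i : ℤ)) = 2 * (d i * val u i) := fun i => by ring
          simp only [this]
          ring
        rw [this]
        omega
    intro u
    refine if_congr ?_ rfl rfl
    rw [key, hf, hf', ← Nat.cast_le (α := ℤ), ← sub_nonneg]
    push_cast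
    simp only [hd, he, sub_mul, Finset.sum_sub_distrib]
    constructor <;> intro h <;> linarith

/-! ### Membership in finitely generated monoids of vectors -/

/-- The elements of the monoid generated by `G`, with the coefficients of the generators split
into their lowest binary digit and the rest. -/
theorem mem_closure_iff_exists_double {M : Type} [AddCommMonoid M] [DecidableEq M]
    (G : Finset M) (x : M) :
    x ∈ AddSubmonoid.closure (G : Set M) ↔
      ∃ F ⊆ G, ∃ y ∈ AddSubmonoid.closure (G : Set M), x = ∑ g ∈ F, g + (y + y) := by
  constructor
  · intro hx
    induction hx using AddSubmonoid.closure_induction with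
    | mem g hg =>
      exact ⟨{g}, Finset.singleton_subset_iff.2 hg, 0, zero_mem _, by simp⟩
    | zero => exact ⟨∅, Finset.empty_subset _, 0, zero_mem _, by simp⟩
    | add x x' _ _ ih ih' =>
      obtain ⟨F, hF, y, hy, rfl⟩ := ih
      obtain ⟨F', hF', y', hy', rfl⟩ := ih'
      refine ⟨F \ F' ∪ F' \ F, Finset.union_subset (Finset.sdiff_subset.trans hF)
        (Finset.sdiff_subset.trans hF'), y + y' + ∑ g ∈ F ∩ F', g, ?_, ?_⟩
      · refine add_mem (add_mem hy hy') (sum_mem fun g hg => ?_)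
        exact AddSubmonoid.subset_closure (hF (Finset.mem_of_mem_inter_left hg))
      · rw [Finset.sum_union (Finset.disjoint_left.2 fun g hg hg' =>
          (Finset.mem_sdiff.1 hg).2 (Finset.mem_sdiff.1 hg').1)]
        have h : ∑ g ∈ F \ F', g + ∑ g ∈ F ∩ F', g = ∑ g ∈ F, g := by
          rw [add_comm, Finset.sum_inter_add_sum_sdiff]
        have h' : ∑ g ∈ F' \ F, g + ∑ g ∈ F ∩ F', g = ∑ g ∈ F', g := by
          rw [add_comm, Finset.inter_comm, Finset.sum_inter_add_sum_sdiff]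
        rw [← h, ← h']
        abel
  · rintro ⟨F, hF, y, hy, rfl⟩
    exact add_mem (sum_mem fun g hg => AddSubmonoid.subset_closure (hF hg)) (add_mem hy hy)

/-- Membership of some of the registers in a fixed finitely generated monoid of vectors is
realizable: reading the digits from the lowest place on, the transducer remembers the set of all
carries that can result from a choice of the lowest digits of the coefficients. -/
theorem Realizable.of_mem_closure {ι κ Q : Type} [Finite κ] (G : Set (κ → ℕ)) (hG : G.Finite)
    (r : κ → ι) (q q' : Q) : Realizable fun v : ι → ℕ =>
      (v, open Classical in if (fun i => v (r i)) ∈ AddSubmonoid.closure G then q else q') := by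
  classical
  lift G to Finset (κ → ℕ) using hG
  have := Fintype.ofFinite κ
  -- all carries stay below this bound
  set N := ∑ g ∈ G, ∑ i, g i with hN
  have hFN : ∀ F ⊆ G, ∀ i, (∑ g ∈ F, g) i ≤ N := by
    intro F hF i
    rw [Finset.sum_apply]
    refine (Finset.sum_le_sum fun g _ => Finset.single_le_sum (f := fun i => g i)
      (fun _ _ => Nat.zero_le _) (Finset.mem_univ i)).trans ?_
    exact Finset.sum_le_sum_of_subset hF
  set next : Set (κ → ℕ) → (ι → Bool) → Set (κ → ℕ) := fun s a =>
    {c' | ∃ c ∈ s, ∃ F ⊆ G, ∀ i, c i + (∑ g ∈ F, g) i = (a (r i)).toNat + 2 * c' i} with hnext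
  have hfin : {c : κ → ℕ | ∀ i, c i ≤ N}.Finite := Set.Finite.pi' fun _ => Set.finite_Iic N
  refine .of_test (St := Set (κ → ℕ)) (𝒫 {c | ∀ i, c i ≤ N}) hfin.finite_subsets
    (init := {0}) (by simp) (next := next) ?_ (fun s => if 0 ∈ s then q else q') fun u =>
      if_congr ?_ rfl rfl
  · rintro s hs a c' ⟨c, hc, F, hF, h⟩ i
    have h₁ := h i
    have h₂ := hFN F hF i
    have h₃ := hs hc i
    omega
  · have key : ∀ (u : List (ι → Bool)) (s : Set (κ → ℕ)), 0 ∈ u.foldl next s ↔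
        ∃ c ∈ s, ∃ x ∈ AddSubmonoid.closure (G : Set (κ → ℕ)),
          (fun i => val u (r i)) = c + x := by
      intro u
      induction u with
      | nil =>
        intro s
        constructor
        · exact fun h => ⟨0, h, 0, zero_mem _, by simp [val]; rfl⟩
        · rintro ⟨c, hc, x, -, h⟩
          have : c = 0 := by
            funext i
            have := congrFun h i
            simp only [val, Pi.add_apply] at this
            simp only [Pi.zero_apply]
            omega
          exact this ▸ hc
      | cons a u ih =>
        intro s
        rw [List.foldl_cons, ih]
        constructor
        · rintro ⟨c', ⟨c, hc, F, hF, h⟩, x, hx, hu⟩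
          refine ⟨c, hc, _, (mem_closure_iff_exists_double G _).2 ⟨F, hF, x, hx, rfl⟩, ?_⟩
          funext i
          have h₁ := congrFun hu i
          have h₂ := h i
          simp only [Pi.add_apply, val] at h₁ h₂ ⊢
          omega
        · rintro ⟨c, hc, x, hx, hu⟩
          obtain ⟨F, hF, y, hy, rfl⟩ := (mem_closure_iff_exists_double G _).1 hx
          refine ⟨fun i => (c i + (∑ g ∈ F, g) i) / 2, ⟨c, hc, F, hF, fun i => ?_⟩, y, hy, ?_⟩
          · have h₁ := congrFun hu i
            dsimp only
            simp only [Pi.add_apply, val] at h₁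
            have : (a (r i)).toNat ≤ 1 := by cases a (r i) <;> simp
            omega
          · funext i
            have h₁ := congrFun hu i
            change val u (r i) = (c i + (∑ g ∈ F, g) i) / 2 + y i
            simp only [Pi.add_apply, val] at h₁
            have : (a (r i)).toNat ≤ 1 := by cases a (r i) <;> simp
            omega
    rw [key]
    simp

/-! ### Kinds of deadlines -/

section Kinds

variable {C : ℕ} (ℓ : Fin C → ℕ)

/-- The product of all job lengths. A block of this total length can be filled with jobs of any one
type. -/
def period : ℕ := ∏ j, ℓ j

variable {ℓ} in
theorem period_pos (hℓ : ∀ j, 0 < ℓ j) : 0 < period ℓ := Finset.prod_pos fun j _ => hℓ j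

theorem dvd_period (j : Fin C) : ℓ j ∣ period ℓ := Finset.dvd_prod_of_mem ℓ (Finset.mem_univ j)

/-- The deadline `D` after removal of as many blocks of length `period ℓ` as possible, subject to
the condition that at least `C * period ℓ` remains (if anything is removed). The condition is what
makes it harmless to treat the blocks as separate, interchangeable units of time, see
`exists_split_blocks`. -/
def residue (D : ℕ) : ℕ :=
  if D < C * period ℓ then D else C * period ℓ + (D - C * period ℓ) % period ℓ

theorem exists_residue_add (D : ℕ) :
    ∃ k, D = residue ℓ D + period ℓ * k ∧ (k ≠ 0 → C * period ℓ ≤ residue ℓ D) := by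
  unfold residue
  split_ifs with h
  · exact ⟨0, by simp, by simp⟩
  · refine ⟨(D - C * period ℓ) / period ℓ, ?_, by simp⟩
    have := Nat.mod_add_div (D - C * period ℓ) (period ℓ)
    omega

theorem residue_add_mul {D : ℕ} (hD : C * period ℓ ≤ D) (k : ℕ) :
    residue ℓ (D + period ℓ * k) = residue ℓ D := by
  unfold residue
  rw [if_neg (by omega), if_neg (by omega), Nat.sub_add_comm hD, Nat.add_mul_mod_self_left]

theorem residue_residue_add (D E : ℕ) :
    residue ℓ (residue ℓ D + residue ℓ E) = residue ℓ (D + E) := by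
  obtain ⟨k, hk, hk'⟩ := exists_residue_add ℓ D
  obtain ⟨l, hl, hl'⟩ := exists_residue_add ℓ E
  by_cases h : k = 0 ∧ l = 0
  · obtain ⟨rfl, rfl⟩ := h
    rw [mul_zero, add_zero] at hk hl
    rw [← hk, ← hl]
  · have : C * period ℓ ≤ residue ℓ D + residue ℓ E := by
      by_cases hk0 : k = 0
      · exact (hl' fun hl0 => h ⟨hk0, hl0⟩).trans (Nat.le_add_left _ _)
      · exact (hk' hk0).trans (Nat.le_add_right _ _)
    rw [← residue_add_mul ℓ this (k + l)]
    congr 1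
    rw [mul_add]
    omega

/-- The finitely many kinds of deadlines. -/
abbrev Kind : Type := Fin (C * period ℓ + period ℓ + 1)

/-- The kind of a deadline is its residue; the residue is smaller than the size of `Kind ℓ`, so
that the reduction in `Fin.ofNat` has no effect, see `val_kind`. -/
def kind (D : ℕ) : Kind ℓ := Fin.ofNat _ (residue ℓ D)

variable {ℓ}

theorem val_kind (hℓ : ∀ j, 0 < ℓ j) (D : ℕ) : (kind ℓ D : ℕ) = residue ℓ D := by
  refine Nat.mod_eq_of_lt ?_
  have := Nat.mod_lt (D - C * period ℓ) (period_pos hℓ)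
  unfold residue
  split_ifs <;> omega

theorem kind_kind_add (hℓ : ∀ j, 0 < ℓ j) (D E : ℕ) :
    kind ℓ (kind ℓ D + kind ℓ E) = kind ℓ (D + E) := by
  rw [val_kind hℓ, val_kind hℓ, kind, residue_residue_add]
  rfl

end Kinds

/-! ### Schedulability as membership in a monoid -/

section Monoid

variable {C : ℕ} {ℓ : Fin C → ℕ}

/-- The coordinates of the vectors by which instances are described: a number of jobs for every
type, a total of deadlines, and a number of machines for every kind of deadline. -/
abbrev Coord (ℓ : Fin C → ℕ) : Type := Fin C ⊕ Unit ⊕ Kind ℓ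

/-- The vector with the given coordinates. -/
def vec (n : Fin C → ℕ) (W : ℕ) (N : Kind ℓ → ℕ) : Coord ℓ → ℕ :=
  Sum.elim n (Sum.elim (fun _ => W) N)

theorem vec_add (n n' : Fin C → ℕ) (W W' : ℕ) (N N' : Kind ℓ → ℕ) :
    vec n W N + vec n' W' N' = vec (n + n') (W + W') (N + N') := by
  funext i; rcases i with j | _ | t <;> rfl

theorem vec_zero : vec (ℓ := ℓ) 0 0 0 = 0 := by
  funext i; rcases i with _ | _ | _ <;> rfl

/-- The job counts `n` can be distributed over machines with the given deadlines (a recursive form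
of the existence of an assignment). -/
def Fits (ℓ : Fin C → ℕ) : List ℕ → (Fin C → ℕ) → Prop
  | [], n => n = 0
  | D :: Ds, n => ∃ x n', n = x + n' ∧ ∑ j, ℓ j * x j ≤ D ∧ Fits ℓ Ds n'

theorem exists_assignment_iff_fits {m : ℕ} (D : Fin m → ℕ) (n : Fin C → ℕ) :
    (∃ x : Fin m → Fin C → ℕ, IsAssignment n x ∧ ∀ i, load ℓ x i ≤ D i) ↔
      Fits ℓ (List.ofFn D) n := by
  induction m generalizing n with
  | zero =>
    simp only [List.ofFn_zero, Fits, IsAssignment, Finset.univ_eq_empty, Finset.sum_empty]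
    exact ⟨fun ⟨_, h, _⟩ => funext fun j => (h j).symm,
      fun h => ⟨fun _ _ => 0, fun j => by simp [h], fun i => i.elim0⟩⟩
  | succ m ih =>
    rw [List.ofFn_succ, Fits]
    constructor
    · rintro ⟨x, hx, hD⟩
      refine ⟨x 0, fun j => ∑ i : Fin m, x i.succ j, ?_, hD 0,
        (ih _ _).1 ⟨fun i => x i.succ, fun j => rfl, fun i => hD i.succ⟩⟩
      funext j
      rw [← hx j, Fin.sum_univ_succ]
      rfl
    · rintro ⟨x, n', rfl, hx, hn'⟩
      obtain ⟨y, hy, hD⟩ := (ih _ _).2 hn'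
      refine ⟨Fin.cons x y, fun j => ?_, fun i => ?_⟩
      · rw [Fin.sum_univ_succ]
        simp [hy j]
      · cases i using Fin.cases with
        | zero => exact hx
        | succ i => exact hD i

/-- Describes an instance: the job counts, the sum of the deadlines and the number of machines of
each kind. -/
def summary (ℓ : Fin C → ℕ) (n : Fin C → ℕ) : List ℕ → Coord ℓ → ℕ
  | [] => vec n 0 0
  | D :: Ds => vec 0 D (Pi.single (kind ℓ D) 1) + summary ℓ n Ds

theorem summary_add (n n' : Fin C → ℕ) (Ds : List ℕ) :
    summary ℓ (n + n') Ds = vec n 0 0 + summary ℓ n' Ds := by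
  induction Ds with
  | nil => simp [summary, vec_add]
  | cons D Ds ih => rw [summary, ih, summary, add_left_comm]

/-- The generators that describe one machine whose deadline equals its residue, filled with jobs
arbitrarily. -/
def machineGens (ℓ : Fin C → ℕ) : Set (Coord ℓ → ℕ) :=
  {v | ∃ (t : Kind ℓ) (x : Fin C → ℕ), ∑ j, ℓ j * x j ≤ t ∧ v = vec x t (Pi.single t 1)}

/-- The generators that describe an additional block of `period ℓ` units of time, which is left
empty or is filled with jobs of one type. -/
def blockGens (ℓ : Fin C → ℕ) : Set (Coord ℓ → ℕ) :=
  insert (vec 0 (period ℓ) 0)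
    (Set.range fun j => vec (Pi.single j (period ℓ / ℓ j)) (period ℓ) 0)

theorem finite_gens (hℓ : ∀ j, 0 < ℓ j) : (machineGens ℓ ∪ blockGens ℓ).Finite := by
  refine Set.Finite.union ?_ ((Set.finite_range _).insert _)
  have : (⋃ t : Kind ℓ, (fun x => vec (ℓ := ℓ) x t (Pi.single t 1)) ''
      {x | ∀ j, x j ∈ Set.Iic (t : ℕ)}).Finite :=
    Set.finite_iUnion fun t => (Set.Finite.pi' fun _ => Set.finite_Iic _).image _
  refine this.subset ?_
  rintro v ⟨t, x, hx, rfl⟩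
  refine Set.mem_iUnion.2 ⟨t, x, fun j => ?_, rfl⟩
  calc x j ≤ ℓ j * x j := Nat.le_mul_of_pos_left _ (hℓ j)
    _ ≤ ∑ j, ℓ j * x j := Finset.single_le_sum (f := fun j => ℓ j * x j)
        (fun _ _ => Nat.zero_le _) (Finset.mem_univ j)
    _ ≤ t := hx

theorem load_add (x y : Fin C → ℕ) :
    ∑ j, ℓ j * (x + y) j = ∑ j, ℓ j * x j + ∑ j, ℓ j * y j := by
  simp only [Pi.add_apply, mul_add, Finset.sum_add_distrib]

theorem load_block (j : Fin C) :
    ∑ i, ℓ i * (Pi.single j (period ℓ / ℓ j) : Fin C → ℕ) i = period ℓ := by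
  rw [Finset.sum_eq_single j (fun i _ hi => by simp [Pi.single_eq_of_ne hi]) (by simp),
    Pi.single_eq_same, Nat.mul_div_cancel' (dvd_period ℓ j)]

/-- A machine whose deadline exceeds `r ≥ C * period ℓ` by a number of blocks can be emptied block
by block: a machine with load more than `C * period ℓ` processes jobs of total length at least
`period ℓ` of some type. -/
theorem exists_split_blocks (r k : ℕ) (hr : k ≠ 0 → C * period ℓ ≤ r)
    (x : Fin C → ℕ) (hx : ∑ j, ℓ j * x j ≤ r + period ℓ * k) :
    ∃ x', ∑ j, ℓ j * x' j ≤ r ∧ ∃ y ∈ AddSubmonoid.closure (blockGens ℓ),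
      vec x (r + period ℓ * k) 0 = vec x' r 0 + y := by
  induction k generalizing x with
  | zero => exact ⟨x, by simpa using hx, 0, zero_mem _, by simp⟩
  | succ k ih =>
    have hr := hr k.succ_ne_zero
    by_cases h : ∑ j, ℓ j * x j ≤ r + period ℓ * k
    · obtain ⟨x', hx', y, hy, he⟩ := ih (fun _ => hr) x h
      refine ⟨x', hx', _, add_mem hy (AddSubmonoid.subset_closure (Set.mem_insert _ _)), ?_⟩
      rw [← add_assoc, ← he, vec_add, mul_add, ← add_assoc]
      simp
    · obtain ⟨j, hj⟩ : ∃ j, period ℓ ≤ ℓ j * x j := by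
        by_contra! hlt
        have := Finset.sum_le_sum fun j (_ : j ∈ Finset.univ) => (hlt j).le
        simp only [Finset.sum_const, Finset.card_univ, Fintype.card_fin, smul_eq_mul] at this
        omega
      have hj' : period ℓ / ℓ j ≤ x j := Nat.div_le_of_le_mul hj
      have hsplit : x - Pi.single j (period ℓ / ℓ j) + Pi.single j (period ℓ / ℓ j) = x := by
        funext i
        rcases eq_or_ne i j with rfl | hi
        · simp [hj']
        · simp [Pi.single_eq_of_ne hi]
      have hload := load_add (ℓ := ℓ) (x - Pi.single j (period ℓ / ℓ j))
        (Pi.single j (period ℓ / ℓ j))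
      rw [hsplit, load_block] at hload
      obtain ⟨x', hx', y, hy, he⟩ := ih (fun _ => hr) (x - Pi.single j (period ℓ / ℓ j))
        (by rw [mul_add] at hx; omega)
      refine ⟨x', hx', _,
        add_mem hy (AddSubmonoid.subset_closure (Set.mem_insert_of_mem _ ⟨j, rfl⟩)), ?_⟩
      rw [← add_assoc, ← he, vec_add, mul_add, ← add_assoc, hsplit]
      simp

theorem summary_mem_of_fits (hℓ : ∀ j, 0 < ℓ j) (Ds : List ℕ) (n : Fin C → ℕ)
    (h : Fits ℓ Ds n) : summary ℓ n Ds ∈ AddSubmonoid.closure (machineGens ℓ ∪ blockGens ℓ) := by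
  induction Ds generalizing n with
  | nil =>
    rw [Fits] at h
    subst h
    rw [summary, vec_zero]
    exact zero_mem _
  | cons D Ds ih =>
    obtain ⟨x, n', rfl, hx, hn'⟩ := h
    obtain ⟨k, hk, hk'⟩ := exists_residue_add ℓ D
    rw [hk] at hx
    obtain ⟨x', hx', y, hy, he⟩ := exists_split_blocks _ k hk' x hx
    have hsum : summary ℓ (x + n') (D :: Ds) =
        vec x' (kind ℓ D) (Pi.single (kind ℓ D) 1) + y + summary ℓ n' Ds := by
      rw [summary, summary_add, ← add_assoc, vec_add, zero_add, add_zero, add_zero]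
      congr 1
      have h₂ : vec x D (Pi.single (kind ℓ D) 1) =
          vec x (residue ℓ D + period ℓ * k) 0 + vec 0 0 (Pi.single (kind ℓ D) 1) := by
        rw [vec_add, ← hk]
        simp
      rw [h₂, he, add_right_comm, vec_add, val_kind hℓ]
      simp
    rw [hsum]
    refine add_mem (add_mem (AddSubmonoid.subset_closure (Or.inl ⟨_, x', ?_, rfl⟩))
      (AddSubmonoid.closure_mono Set.subset_union_right hy)) (ih n' hn')
    rwa [val_kind hℓ]

theorem sum_apply_list {ι : Type} (l : List (ι → ℕ)) (i : ι) :
    l.sum i = (l.map fun v => v i).sum := by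
  induction l with
  | nil => rfl
  | cons a l ih => simp [ih]

theorem total_machines (l : List (Coord ℓ → ℕ)) (hl : ∀ g ∈ l, g ∈ machineGens ℓ) :
    l.sum (.inr (.inl ())) = ∑ t : Kind ℓ, (t : ℕ) * l.sum (.inr (.inr t)) := by
  induction l with
  | nil => simp
  | cons a l ih =>
    obtain ⟨t, x, -, rfl⟩ := hl a List.mem_cons_self
    simp only [List.sum_cons, Pi.add_apply, mul_add, Finset.sum_add_distrib]
    rw [ih fun g hg => hl g (List.mem_cons_of_mem _ hg)]
    simp [vec, Pi.single_apply]

theorem total_blocks (l : List (Coord ℓ → ℕ)) (hl : ∀ g ∈ l, g ∈ blockGens ℓ) :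
    l.sum (.inr (.inl ())) = period ℓ * l.length ∧ (∀ t, l.sum (.inr (.inr t)) = 0) ∧
      ∑ j, ℓ j * l.sum (.inl j) ≤ period ℓ * l.length := by
  induction l with
  | nil => simp
  | cons a l ih =>
    obtain ⟨h₁, h₂, h₃⟩ := ih fun g hg => hl g (List.mem_cons_of_mem _ hg)
    simp only [List.sum_cons, Pi.add_apply, List.length_cons, mul_add, Finset.sum_add_distrib,
      h₁, h₂]
    obtain rfl | ⟨j, rfl⟩ := hl a List.mem_cons_self
    · refine ⟨?_, ?_, ?_⟩
      · simp [vec]; omega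
      · simp [vec]
      · simp [vec]; omega
    · have := load_block (ℓ := ℓ) j
      refine ⟨?_, ?_, ?_⟩
      · simp [vec]; omega
      · simp [vec]
      · simp only [vec, Sum.elim_inl]; omega

theorem summary_kinds (hℓ : ∀ j, 0 < ℓ j) (n : Fin C → ℕ) (Ds : List ℕ) :
    ∑ t : Kind ℓ, (t : ℕ) * summary ℓ n Ds (.inr (.inr t)) ≤ summary ℓ n Ds (.inr (.inl ())) := by
  induction Ds with
  | nil => simp [summary, vec]
  | cons D Ds ih =>
    simp only [summary, Pi.add_apply, mul_add, Finset.sum_add_distrib]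
    refine Nat.add_le_add ?_ ih
    obtain ⟨k, hk, -⟩ := exists_residue_add ℓ D
    simp only [vec, Sum.elim_inr, Sum.elim_inl, Pi.single_apply, mul_ite, mul_one, mul_zero,
      Finset.sum_ite_eq', Finset.mem_univ, if_true, val_kind hℓ]
    omega

theorem summary_job (n : Fin C → ℕ) (Ds : List ℕ) (j : Fin C) :
    summary ℓ n Ds (.inl j) = n j := by
  induction Ds with
  | nil => rfl
  | cons D Ds ih => rw [summary, Pi.add_apply, ih]; simp [vec]

theorem summary_of_ne_job (n n' : Fin C → ℕ) (Ds : List ℕ) (i : Unit ⊕ Kind ℓ) :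
    summary ℓ n Ds (.inr i) = summary ℓ n' Ds (.inr i) := by
  induction Ds with
  | nil => rfl
  | cons D Ds ih => rw [summary, Pi.add_apply, ih]; rfl

/-- Generators that sum up to the description of an instance yield a schedule: the machine
generators of a kind are assigned to the machines of that kind, and each machine is filled up with
as many blocks as its deadline exceeds its residue by. Since the totals agree, there are exactly as
many blocks as needed, and it does not matter which machine receives which blocks. -/
theorem fits_of_sum_eq (hℓ : ∀ j, 0 < ℓ j) (Ds : List ℕ) (n : Fin C → ℕ)
    (l l' : List (Coord ℓ → ℕ)) (hl : ∀ g ∈ l, g ∈ machineGens ℓ) (hl' : ∀ g ∈ l', g ∈ blockGens ℓ)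
    (h : l.sum + l'.sum = summary ℓ n Ds) : Fits ℓ Ds n := by
  classical
  have hpos := period_pos hℓ
  induction Ds generalizing n l l' with
  | nil =>
    have hl'0 : l' = [] := by
      have h₁ := congrFun h (.inr (.inl ()))
      have h₂ := (total_blocks l' hl').1
      simp only [summary, vec, Sum.elim_inr, Sum.elim_inl, Pi.add_apply] at h₁
      rw [← List.length_eq_zero_iff]
      by_contra h0
      have := Nat.mul_pos hpos (Nat.pos_of_ne_zero h0)
      omega
    have hl0 : l = [] := by
      cases l with
      | nil => rfl
      | cons a l =>
        obtain ⟨t, x, -, rfl⟩ := hl a List.mem_cons_self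
        have h₁ := congrFun h (.inr (.inr t))
        simp [summary, vec] at h₁
    subst hl0 hl'0
    funext j
    simpa [summary, vec] using (congrFun h (.inl j)).symm
  | cons D Ds ih =>
    obtain ⟨k, hk, -⟩ := exists_residue_add ℓ D
    -- some machine generator belongs to the kind of `D`
    obtain ⟨x, hx, hmem⟩ : ∃ x, ∑ j, ℓ j * x j ≤ residue ℓ D ∧
        vec x (residue ℓ D) (Pi.single (kind ℓ D) 1) ∈ l := by
      have h₁ := congrFun h (.inr (.inr (kind ℓ D)))
      rw [Pi.add_apply, (total_blocks l' hl').2.1, add_zero, summary, Pi.add_apply] at h₁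
      have h₂ : l.sum (.inr (.inr (kind ℓ D))) ≠ 0 := by
        rw [h₁]
        simp [vec]
      rw [sum_apply_list, Ne, List.sum_eq_zero_iff] at h₂
      push Not at h₂
      obtain ⟨_, hy, hne⟩ := h₂
      obtain ⟨v, hv, rfl⟩ := List.mem_map.1 hy
      obtain ⟨t, x, hx, rfl⟩ := hl v hv
      have ht : t = kind ℓ D := by
        by_contra hne'
        exact hne (by simp [vec, Pi.single_eq_of_ne (Ne.symm hne')])
      subst ht
      rw [val_kind hℓ] at hx hv
      exact ⟨x, hx, hv⟩
    have hsum := List.sum_erase hmem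
    set m := l.erase (vec x (residue ℓ D) (Pi.single (kind ℓ D) 1)) with hm
    have hml : ∀ g ∈ m, g ∈ machineGens ℓ := fun g hg => hl g (List.mem_of_mem_erase hg)
    -- there are enough blocks to fill up the machine, by comparison of the totals
    have hkl : k ≤ l'.length := by
      have h₁ := congrFun h (.inr (.inl ()))
      have h₂ := total_machines l hl
      have h₃ := summary_kinds hℓ n Ds
      have h₄ : ∀ t, l.sum (.inr (.inr t)) =
          (Pi.single (kind ℓ D) 1 : Kind ℓ → ℕ) t + summary ℓ n Ds (.inr (.inr t)) := fun t => by
        have := congrFun h (.inr (.inr t))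
        rw [Pi.add_apply, (total_blocks l' hl').2.1, add_zero, summary, Pi.add_apply] at this
        exact this
      simp only [h₄, mul_add, Finset.sum_add_distrib, Pi.single_apply, mul_ite, mul_one, mul_zero,
        Finset.sum_ite_eq', Finset.mem_univ, if_true, val_kind hℓ] at h₂
      rw [Pi.add_apply, (total_blocks l' hl').1, summary, Pi.add_apply] at h₁
      simp only [vec, Sum.elim_inr, Sum.elim_inl] at h₁
      exact Nat.le_of_mul_le_mul_left (by omega) hpos
    obtain ⟨hb₁, hb₂, hb₃⟩ := total_blocks (l'.take k) fun g hg => hl' g (List.mem_of_mem_take hg)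
    rw [List.length_take_of_le hkl] at hb₁ hb₃
    have hl'sum := List.sum_take_add_sum_drop l' k
    rw [← hsum, ← hl'sum] at h
    refine ⟨fun j => x j + (l'.take k).sum (.inl j),
      fun j => m.sum (.inl j) + (l'.drop k).sum (.inl j), ?_, ?_,
      ih _ m (l'.drop k) hml (fun g hg => hl' g (List.mem_of_mem_drop hg)) ?_⟩
    · funext j
      have h₁ := congrFun h (.inl j)
      simp only [summary_job, Pi.add_apply, vec, Sum.elim_inl] at h₁ ⊢
      omega
    · simp only [mul_add, Finset.sum_add_distrib]
      omega
    · funext i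
      have h₁ := congrFun h i
      rcases i with j | _ | t
      · rw [summary_job]; rfl
      · rw [summary_of_ne_job _ n]
        simp only [summary, Pi.add_apply, vec, Sum.elim_inl, Sum.elim_inr, hb₁] at h₁ ⊢
        omega
      · rw [summary_of_ne_job _ n]
        simp only [summary, Pi.add_apply, vec, Sum.elim_inr, hb₂] at h₁ ⊢
        omega

/-- Schedulability only depends on the job counts, the sum of the deadlines and the number of
machines of each kind, and it is a membership in a fixed finitely generated monoid. -/
theorem fits_iff_summary_mem (hℓ : ∀ j, 0 < ℓ j) (Ds : List ℕ) (n : Fin C → ℕ) :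
    Fits ℓ Ds n ↔ summary ℓ n Ds ∈ AddSubmonoid.closure (machineGens ℓ ∪ blockGens ℓ) := by
  refine ⟨summary_mem_of_fits hℓ Ds n, fun h => ?_⟩
  rw [AddSubmonoid.closure_union, AddSubmonoid.mem_sup] at h
  obtain ⟨a, ha, b, hb, hab⟩ := h
  obtain ⟨l, hl, rfl⟩ := AddSubmonoid.exists_list_of_mem_closure ha
  obtain ⟨l', hl', rfl⟩ := AddSubmonoid.exists_list_of_mem_closure hb
  exact fits_of_sum_eq hℓ Ds n l l' hl hl' hab

end Monoid

/-! ### Words that encode lists of numbers -/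

/-- The number with the given binary digits, least significant digit first. -/
def bitsVal : List Bool → ℕ
  | [] => 0
  | b :: l => b.toNat + 2 * bitsVal l

theorem bitsVal_lt (l : List Bool) : bitsVal l < 2 ^ l.length := by
  induction l with
  | nil => simp [bitsVal]
  | cons b l ih =>
    have := Bool.toNat_le b
    rw [bitsVal, List.length_cons, pow_succ]
    omega

theorem bitsVal_encodeNat (n : ℕ) : bitsVal (encodeNat n) = n := by
  have hpos : ∀ p : PosNum, bitsVal (encodePosNum p) = p := by
    intro p
    induction p with
    | one => rfl
    | bit1 p ih => simp only [encodePosNum, bitsVal, ih, PosNum.cast_bit1, Bool.toNat_true]; omega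
    | bit0 p ih => simp only [encodePosNum, bitsVal, ih, PosNum.cast_bit0, Bool.toNat_false]; omega
  have hnum : ∀ m : Num, bitsVal (encodeNum m) = m := by
    rintro (_ | p)
    · rfl
    · exact hpos p
  exact (hnum n).trans (Num.to_of_nat n)

theorem getLast?_encodeNat (n : ℕ) : (encodeNat n).getLast? ≠ some false := by
  have hpos : ∀ p : PosNum, (encodePosNum p).getLast? = some true := by
    intro p
    induction p with
    | one => rfl
    | bit1 p ih => rw [encodePosNum, List.getLast?_cons, ih]; rfl
    | bit0 p ih => rw [encodePosNum, List.getLast?_cons, ih]; rfl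
  have hnum : ∀ m : Num, (encodeNum m).getLast? ≠ some false := by
    rintro (_ | p)
    · simp [encodeNum]
    · simp [encodeNum, hpos p]
  exact hnum n

theorem eq_of_bitsVal_eq : ∀ {l l' : List Bool}, l.getLast? ≠ some false →
    l'.getLast? ≠ some false → bitsVal l = bitsVal l' → l = l' := by
  have hzero : ∀ l : List Bool, l.getLast? ≠ some false → bitsVal l = 0 → l = [] := by
    intro l
    induction l with
    | nil => simp
    | cons b l ih =>
      intro h h0
      cases b with
      | true => simp [bitsVal] at h0
      | false =>
        have : l = [] := by
          refine ih (fun h' => h ?_) (by simpa [bitsVal] using h0)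
          rw [List.getLast?_cons, h']
          rfl
        simp [this] at h
  intro l
  induction l with
  | nil => exact fun _ h' h => (hzero _ h' h.symm).symm
  | cons b l ih =>
    intro l' h h' he
    cases l' with
    | nil => exact hzero _ h he
    | cons b' l' =>
      have htail : ∀ (b : Bool) (l : List Bool), (b :: l).getLast? ≠ some false →
          l.getLast? ≠ some false := by
        intro b l h h'
        rw [List.getLast?_cons, h'] at h
        exact h rfl
      have hb := Bool.toNat_le b
      have hb' := Bool.toNat_le b'
      simp only [bitsVal] at he
      have hbb : b.toNat = b'.toNat := by omega
      rw [ih (htail _ _ h) (htail _ _ h') (by omega)]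
      cases b <;> cases b' <;> simp_all

/-- A word of digits is the canonical encoding of its value unless its highest digit is zero. -/
theorem encodeNat_bitsVal {l : List Bool} (h : l.getLast? ≠ some false) :
    encodeNat (bitsVal l) = l :=
  eq_of_bitsVal_eq (getLast?_encodeNat _) h (bitsVal_encodeNat _)

/-- The encoding of `n` and the comma after it, followed by `w`. -/
def numCons (n : ℕ) (w : List Γ') : List Γ' := (encodeNat n).map Γ'.bit ++ Γ'.comma :: w

theorem encodeNumbers_nil : encodeNumbers [] = [] := rfl

theorem encodeNumbers_cons (n : ℕ) (L : List ℕ) :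
    encodeNumbers (n :: L) = numCons n (encodeNumbers L) := by
  change ((encodeNat n).map Γ'.bit ++ [Γ'.comma]) ++ encodeNumbers L = _
  rw [List.append_assoc]
  rfl

theorem encodeNumbers_append (L L' : List ℕ) :
    encodeNumbers (L ++ L') = encodeNumbers L ++ encodeNumbers L' :=
  List.flatMap_append

theorem numCons_append (n : ℕ) (w w' : List Γ') : numCons n w ++ w' = numCons n (w ++ w') := by
  simp [numCons]

theorem length_lt_length_numCons (n : ℕ) (w : List Γ') : w.length < (numCons n w).length := by
  simp [numCons]
  omega

theorem lt_two_pow_length_numCons (n : ℕ) (w : List Γ') : n < 2 ^ (numCons n w).length := by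
  conv_lhs => rw [← bitsVal_encodeNat n]
  refine (bitsVal_lt _).trans_le (Nat.pow_le_pow_right two_pos ?_)
  simp [numCons]

theorem bits_append_inj {x x' : Γ'} (hx : ∀ b, x ≠ .bit b) (hx' : ∀ b, x' ≠ .bit b) :
    ∀ {l l' : List Bool} {w w' : List Γ'},
      l.map Γ'.bit ++ x :: w = l'.map Γ'.bit ++ x' :: w' → l = l' ∧ x = x' ∧ w = w' := by
  intro l
  induction l with
  | nil =>
    rintro (_ | ⟨b, l'⟩) w w' h
    · simpa using h
    · exact absurd (by simpa using (List.cons.inj h).1) (hx b)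
  | cons b l ih =>
    rintro (_ | ⟨b', l'⟩) w w' h
    · exact absurd (by simpa using (List.cons.inj h).1.symm) (hx' b)
    · simp only [List.map_cons, List.cons_append, List.cons.injEq, Γ'.bit.injEq] at h
      obtain ⟨h₁, h₂, h₃⟩ := ih h.2
      exact ⟨by rw [h.1, h₁], h₂, h₃⟩

theorem numCons_inj {n n' : ℕ} {w w' : List Γ'} (h : numCons n w = numCons n' w') :
    n = n' ∧ w = w' := by
  obtain ⟨h₁, -, h₂⟩ := bits_append_inj (by simp) (by simp) h
  refine ⟨?_, h₂⟩
  rw [← bitsVal_encodeNat n, h₁, bitsVal_encodeNat]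

theorem numCons_ne_nil (n : ℕ) (w : List Γ') : numCons n w ≠ [] := by
  simp [numCons]

/-- Every word starts with a (possibly empty) block of digits. -/
theorem exists_bits_append (w : List Γ') : ∃ (l : List Bool) (w' : List Γ'),
    w = l.map Γ'.bit ++ w' ∧ ∀ x ∈ w'.head?, ∀ b, x ≠ .bit b := by
  induction w with
  | nil => exact ⟨[], [], rfl, by simp⟩
  | cons x w ih =>
    by_cases hx : ∃ b, x = .bit b
    · obtain ⟨b, rfl⟩ := hx
      obtain ⟨l, w', rfl, h⟩ := ih
      exact ⟨b :: l, w', rfl, h⟩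
    · exact ⟨[], x :: w, rfl, by simpa using hx⟩

/-! ### The decision program -/

section Program

variable {C : ℕ} (ℓ : Fin C → ℕ)

/-- The auxiliary registers. -/
inductive Aux
  | dnum | dden | prod | divisor | done | step | unit | acc
  deriving DecidableEq

instance : Fintype Aux :=
  ⟨{.dnum, .dden, .prod, .divisor, .done, .step, .unit, .acc},
    by rintro (_ | _ | _ | _ | _ | _ | _ | _) <;> simp⟩

/-- The registers of the decision program: a vector that describes the part of the instance read so
far, and auxiliary registers. -/
abbrev Reg : Type := Coord ℓ ⊕ Aux

/-- The contents of the registers.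
* `sum` sums up the descriptions of the job counts and of the machines;
* `dnum / dden` is the common deadline (`1 / 1` for machine-dependent deadlines);
* `prod / divisor` is the quotient to be rounded down to the deadline of a machine, and `done` is
  the multiple of `divisor` that has been accounted for;
* `step = unit * divisor` in a division, where `unit` is a power of two;
* `acc` is the value of the digits of a number read so far, multiplied by the initial value of
  `unit`, which is doubled for each digit. -/
structure Regs where
  sum : Coord ℓ → ℕ
  dnum : ℕ
  dden : ℕ
  prod : ℕ
  divisor : ℕ
  done : ℕ
  step : ℕ
  unit : ℕ
  acc : ℕ

variable {ℓ}

/-- The register contents as a function. -/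
def Regs.toFun (s : Regs ℓ) : Reg ℓ → ℕ
  | .inl i => s.sum i
  | .inr .dnum => s.dnum
  | .inr .dden => s.dden
  | .inr .prod => s.prod
  | .inr .divisor => s.divisor
  | .inr .done => s.done
  | .inr .step => s.step
  | .inr .unit => s.unit
  | .inr .acc => s.acc

/-- The register contents given by a function. -/
def Regs.ofFun (v : Reg ℓ → ℕ) : Regs ℓ where
  sum i := v (.inl i)
  dnum := v (.inr .dnum)
  dden := v (.inr .dden)
  prod := v (.inr .prod)
  divisor := v (.inr .divisor)
  done := v (.inr .done)
  step := v (.inr .step)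
  unit := v (.inr .unit)
  acc := v (.inr .acc)

/-- The role of a number of the input: a job count, numerator or denominator of the common
deadline, or numerator or denominator of the speed of a machine. A machine-dependent deadline is
treated like the numerator of a speed. -/
inductive Role (C : ℕ)
  | count (j : Fin C)
  | dnum
  | dden
  | snum
  | sden
  deriving DecidableEq

variable (ℓ) in
/-- The control states of the decision program. -/
inductive Ctl
  | init
  | start (r : Role C)
  | digit (r : Role C) (last : Option Bool)
  | bit (r : Role C) (b : Bool)
  | stored (r : Role C)
  | outer (ρ : Kind ℓ)
  | fresh (ρ : Kind ℓ)
  | inner (ρ μ : Kind ℓ)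
  | double (ρ μ : Kind ℓ)
  | take (ρ μ : Kind ℓ)
  | close (ρ : Kind ℓ)
  | final
  | halt (b : Bool)

instance : Finite (Role C) :=
  Finite.of_injective
    (fun r : Role C => (match r with
      | .count j => .inl j
      | .dnum => .inr (false, false)
      | .dden => .inr (false, true)
      | .snum => .inr (true, false)
      | .sden => .inr (true, true) : Fin C ⊕ Bool × Bool))
    (by rintro (_ | _) (_ | _) h <;> simp_all)

instance : Finite (Ctl ℓ) :=
  Finite.of_injective
    (fun q : Ctl ℓ => (match q with
      | .init => (0, none, none, none, none, none)
      | .start r => (1, some r, none, none, none, none)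
      | .digit r o => (2, some r, o, none, none, none)
      | .bit r b => (3, some r, some b, none, none, none)
      | .stored r => (4, some r, none, none, none, none)
      | .outer ρ => (5, none, none, some ρ, none, none)
      | .fresh ρ => (6, none, none, some ρ, none, none)
      | .inner ρ μ => (7, none, none, some ρ, some μ, none)
      | .double ρ μ => (8, none, none, some ρ, some μ, none)
      | .take ρ μ => (9, none, none, some ρ, some μ, none)
      | .close ρ => (10, none, none, some ρ, none, none)
      | .final => (11, none, none, none, none, none)
      | .halt b => (12, none, some b, none, none, none) :
      Fin 13 × Option (Role C) × Option Bool × Option (Kind ℓ) × Option (Kind ℓ) × Option Unit))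
    (by rintro (_ | _) (_ | _) h <;> simp_all)

/-- The first number that has not been read after `k` job counts have been read. -/
def countRole (uni : Bool) (k : ℕ) : Role C :=
  if h : k < C then .count ⟨k, h⟩ else if uni then .dnum else .snum

/-- The roles of the numbers that must not be zero. -/
def mustPos (uni : Bool) : Role C → Bool
  | .count _ => false
  | .dnum => false
  | .dden => true
  | .snum => uni
  | .sden => true

/-- The number by which a number of the input is multiplied when it is read. -/
def initialUnit (s : Regs ℓ) : Role C → ℕ
  | .count _ => 1
  | .dnum => 1
  | .dden => 1
  | .snum => s.dnum
  | .sden => s.dden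

/-- An instruction that changes the registers and goes to the control state `q`. -/
def setRegs (h : Regs ℓ → Regs ℓ) (q : Ctl ℓ) : Instr (Reg ℓ) (Ctl ℓ) :=
  .upd fun v => ((h (.ofFun v)).toFun, q)

open Classical in
/-- An instruction that tests the registers. -/
noncomputable def testRegs (p : Regs ℓ → Prop) (q q' : Ctl ℓ) : Instr (Reg ℓ) (Ctl ℓ) :=
  .upd fun v => (v, if p (.ofFun v) then q else q')

variable (ℓ) in
/-- The monoid of the descriptions of schedulable instances. -/
def schedulableMonoid : AddSubmonoid (Coord ℓ → ℕ) :=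
  AddSubmonoid.closure (machineGens ℓ ∪ blockGens ℓ)

variable (ℓ) in
/-- The program that decides both scheduling problems: the flag `uni` tells whether the machines
are uniform (with speeds and a common deadline).

The numbers are read digit by digit in `digit`. For each machine, `prod` and `divisor` are set to
`a * p` and `b * q`, where `a / b` is the deadline and `p / q` the speed of the machine, and
the loop `outer` repeatedly takes the largest possible multiple `2 ^ i * divisor` away from what is
left of `prod`, which is found by doubling in the loop `inner`. The control states of these loops
remember the kind `ρ` of the quotient found so far, and the kind `μ` of `unit = 2 ^ i`. -/
noncomputable def program (uni : Bool) : Ctl ℓ → Instr (Reg ℓ) (Ctl ℓ)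
  | .init => setRegs (fun s => { s with dnum := 1, dden := 1 }) (.start (countRole uni 0))
  | .start r =>
    setRegs (fun s => { s with acc := 0, unit := initialUnit s r }) (.digit r none)
  | .digit r last => .read fun
    | some (.bit b) => .bit r b
    | some .comma =>
      if last = some false ∨ last = none ∧ mustPos uni r then .halt false else .stored r
    | none => if r = .snum ∧ last = none then .final else .halt false
    | _ => .halt false
  | .bit r b =>
    setRegs (fun s => { s with acc := s.acc + b.toNat * s.unit, unit := 2 * s.unit })
      (.digit r (some b))
  | .stored (.count j) =>
    setRegs (fun s => { s with sum := s.sum + vec (fun i => if i = j then s.acc else 0) 0 0 })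
      (.start (countRole uni (j + 1)))
  | .stored .dnum => setRegs (fun s => { s with dnum := s.acc }) (.start .dden)
  | .stored .dden => setRegs (fun s => { s with dden := s.acc }) (.start .snum)
  | .stored .snum =>
    setRegs (fun s => { s with prod := s.acc, divisor := s.dden, done := 0 })
      (if uni then .start .sden else .outer (kind ℓ 0))
  | .stored .sden => setRegs (fun s => { s with divisor := s.acc }) (.outer (kind ℓ 0))
  | .outer ρ => testRegs (fun s => s.done + s.divisor ≤ s.prod) (.fresh ρ) (.close ρ)
  | .fresh ρ => setRegs (fun s => { s with step := s.divisor, unit := 1 }) (.inner ρ (kind ℓ 1))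
  | .inner ρ μ => testRegs (fun s => s.done + 2 * s.step ≤ s.prod) (.double ρ μ) (.take ρ μ)
  | .double ρ μ =>
    setRegs (fun s => { s with step := 2 * s.step, unit := 2 * s.unit })
      (.inner ρ (kind ℓ (μ + μ : ℕ)))
  | .take ρ μ =>
    setRegs (fun s => { s with done := s.done + s.step, sum := s.sum + vec 0 s.unit 0 })
      (.outer (kind ℓ (ρ + μ : ℕ)))
  | .close ρ =>
    setRegs (fun s => { s with sum := s.sum + vec 0 0 (Pi.single ρ 1) }) (.start .snum)
  | .final => testRegs (fun s => s.sum ∈ schedulableMonoid ℓ) (.halt true) (.halt false)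
  | .halt b => .halt b

theorem setRegs_realizable {h : Regs ℓ → Regs ℓ} {q : Ctl ℓ} {g} (hg : setRegs h q = .upd g)
    (hh : ∀ i, IsAffine fun v => (h (.ofFun v)).toFun i) : Realizable g := by
  cases hg
  exact .of_affine hh q

theorem program_realizable (hℓ : ∀ j, 0 < ℓ j) (uni : Bool) (q : Ctl ℓ)
    (g : (Reg ℓ → ℕ) → (Reg ℓ → ℕ) × Ctl ℓ) (h : program ℓ uni q = .upd g) : Realizable g := by
  have hp : ∀ i, IsAffine fun v : Reg ℓ → ℕ => v i := IsAffine.proj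
  have hc : ∀ c, IsAffine fun _ : Reg ℓ → ℕ => c := IsAffine.const
  cases q with
  | init | fresh | double =>
    rw [program] at h
    refine setRegs_realizable h ?_
    rintro (i | _ | _ | _ | _ | _ | _ | _ | _)
    all_goals first | exact hp _ | exact hc _ | exact (hp _).const_mul 2
  | start r =>
    rw [program] at h
    refine setRegs_realizable h ?_
    cases r <;> rintro (i | _ | _ | _ | _ | _ | _ | _ | _)
    all_goals first | exact hp _ | exact hc _
  | bit r b =>
    rw [program] at h
    refine setRegs_realizable h ?_
    rintro (i | _ | _ | _ | _ | _ | _ | _ | _)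
    all_goals first
      | exact hp _ | exact (hp _).const_mul 2 | exact (hp _).add ((hp _).const_mul _)
  | take ρ μ =>
    rw [program] at h
    refine setRegs_realizable h ?_
    rintro ((i | _ | i) | _ | _ | _ | _ | _ | _ | _ | _)
    all_goals first
      | exact hp _ | exact (hp _).add (hp _)
  | close ρ =>
    rw [program] at h
    refine setRegs_realizable h ?_
    rintro ((i | _ | i) | _ | _ | _ | _ | _ | _ | _ | _)
    all_goals first
      | exact hp _ | exact (hp _).add (hc _)
  | stored r =>
    cases r with
    | count j =>
      rw [program] at h
      refine setRegs_realizable h ?_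
      rintro ((i | _ | i) | _ | _ | _ | _ | _ | _ | _ | _)
      · refine (hp (.inl (.inl i))).add (f' := fun v => if i = j then v (.inr .acc) else 0) ?_
        split_ifs
        · exact hp _
        · exact hc _
      all_goals exact hp _
    | dnum | dden | sden | snum =>
      rw [program] at h
      refine setRegs_realizable h ?_
      rintro (i | _ | _ | _ | _ | _ | _ | _ | _)
      all_goals first | exact hp _ | exact hc _
  | outer ρ =>
    cases h
    convert Realizable.of_le ((hp (.inr .done)).add (hp (.inr .divisor))) (hp (.inr .prod))
      (Ctl.fresh ρ) (.close ρ)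
    all_goals rfl
  | inner ρ μ =>
    cases h
    convert Realizable.of_le ((hp (.inr .done)).add ((hp (.inr .step)).const_mul 2))
      (hp (.inr .prod)) (Ctl.double ρ μ) (.take ρ μ)
    all_goals rfl
  | final =>
    cases h
    exact .of_mem_closure _ (finite_gens hℓ) Sum.inl _ _
  | digit r last => cases h
  | halt b => cases h

end Program

/-! ### Runs of the decision program -/

section Verification

variable {C : ℕ} {ℓ : Fin C → ℕ} {uni : Bool}

/-- The configuration with the given control state, input and register contents. -/
def conf (q : Ctl ℓ) (w : List Γ') (s : Regs ℓ) : Conf (Ctl ℓ) (Reg ℓ → ℕ) := ⟨q, w, s.toFun⟩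

/-- The program leads from `c` to `c'` in at most `t` steps. -/
def Reaches (uni : Bool) (t : ℕ) (c c' : Conf (Ctl ℓ) (Reg ℓ → ℕ)) : Prop :=
  ∃ k ≤ t, (progStep (program ℓ uni))^[k] c = c'

/-- Started in `c`, the program halts within `t` steps with the truth value of `p`. -/
def Decides (uni : Bool) (t : ℕ) (c : Conf (Ctl ℓ) (Reg ℓ → ℕ)) (p : Prop) : Prop :=
  ∃ k ≤ t, ∃ b : Bool, (b = true ↔ p) ∧
    program ℓ uni ((progStep (program ℓ uni))^[k] c).state = .halt b

theorem Reaches.refl (c : Conf (Ctl ℓ) (Reg ℓ → ℕ)) : Reaches uni 0 c c := ⟨0, le_rfl, rfl⟩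

theorem Reaches.single {c c' : Conf (Ctl ℓ) (Reg ℓ → ℕ)}
    (h : progStep (program ℓ uni) c = c') : Reaches uni 1 c c' := ⟨1, le_rfl, h⟩

theorem Reaches.trans {t t' : ℕ} {c c' c'' : Conf (Ctl ℓ) (Reg ℓ → ℕ)} (h : Reaches uni t c c')
    (h' : Reaches uni t' c' c'') : Reaches uni (t + t') c c'' := by
  obtain ⟨k, hk, rfl⟩ := h
  obtain ⟨k', hk', rfl⟩ := h'
  exact ⟨k' + k, by omega, Function.iterate_add_apply _ _ _ _⟩

theorem Reaches.mono {t t' : ℕ} {c c' : Conf (Ctl ℓ) (Reg ℓ → ℕ)} (h : Reaches uni t c c')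
    (ht : t ≤ t') : Reaches uni t' c c' :=
  let ⟨k, hk, h⟩ := h
  ⟨k, hk.trans ht, h⟩

theorem Reaches.decides {t t' : ℕ} {c c' : Conf (Ctl ℓ) (Reg ℓ → ℕ)} {p : Prop}
    (h : Reaches uni t c c') (h' : Decides uni t' c' p) : Decides uni (t + t') c p := by
  obtain ⟨k, hk, rfl⟩ := h
  obtain ⟨k', hk', b, hb, hh⟩ := h'
  exact ⟨k' + k, by omega, b, hb, by rwa [Function.iterate_add_apply]⟩

theorem Decides.mono {t t' : ℕ} {c : Conf (Ctl ℓ) (Reg ℓ → ℕ)} {p : Prop}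
    (h : Decides uni t c p) (ht : t ≤ t') : Decides uni t' c p :=
  let ⟨k, hk, h⟩ := h
  ⟨k, hk.trans ht, h⟩

theorem Decides.congr {t : ℕ} {c : Conf (Ctl ℓ) (Reg ℓ → ℕ)} {p p' : Prop}
    (h : Decides uni t c p) (hp : p ↔ p') : Decides uni t c p' :=
  let ⟨k, hk, b, hb, hh⟩ := h
  ⟨k, hk, b, hb.trans hp, hh⟩

theorem decides_halt {b : Bool} {w : List Γ'} {s : Regs ℓ} {p : Prop} (h : b = true ↔ p) :
    Decides uni 0 (conf (.halt b) w s) p :=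
  ⟨0, le_rfl, b, h, rfl⟩

theorem reaches_set {q q' : Ctl ℓ} {h : Regs ℓ → Regs ℓ} (hq : program ℓ uni q = setRegs h q')
    (w : List Γ') (s : Regs ℓ) : Reaches uni 1 (conf q w s) (conf q' w (h s)) := by
  refine Reaches.single ?_
  simp only [progStep, conf, hq, setRegs]
  rfl

theorem reaches_test_true {q q' q'' : Ctl ℓ} {p : Regs ℓ → Prop}
    (hq : program ℓ uni q = testRegs p q' q'') (w : List Γ') {s : Regs ℓ} (hs : p s) :
    Reaches uni 1 (conf q w s) (conf q' w s) := by
  refine Reaches.single ?_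
  simp only [progStep, conf, hq, testRegs]
  exact congrArg (fun q => (⟨q, w, s.toFun⟩ : Conf _ _)) (if_pos hs)

theorem reaches_test_false {q q' q'' : Ctl ℓ} {p : Regs ℓ → Prop}
    (hq : program ℓ uni q = testRegs p q' q'') (w : List Γ') {s : Regs ℓ} (hs : ¬ p s) :
    Reaches uni 1 (conf q w s) (conf q'' w s) := by
  refine Reaches.single ?_
  simp only [progStep, conf, hq, testRegs]
  exact congrArg (fun q => (⟨q, w, s.toFun⟩ : Conf _ _)) (if_neg hs)

/-! ### Reading numbers -/

/-- In front of a block of digits, the program adds up the value of the digits in `acc` and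
remembers the last digit, by which superfluous zeros and empty blocks are recognized. -/
theorem reaches_digits (r : Role C) (l : List Bool) (last : Option Bool) (w : List Γ')
    (s : Regs ℓ) :
    Reaches uni (2 * l.length) (conf (.digit r last) (l.map Γ'.bit ++ w) s)
      (conf (.digit r (l.getLast?.or last)) w
        { s with acc := s.acc + bitsVal l * s.unit, unit := 2 ^ l.length * s.unit }) := by
  induction l generalizing last s with
  | nil =>
    simp only [List.length_nil, bitsVal, zero_mul, add_zero, pow_zero, one_mul]
    exact Reaches.refl _
  | cons b l ih =>
    have h₁ : Reaches uni 1 (conf (.digit r last) ((b :: l).map Γ'.bit ++ w) s)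
        (conf (.bit r b) (l.map Γ'.bit ++ w) s) := Reaches.single rfl
    have h₂ := reaches_set (uni := uni) (q := .bit r b) (by rw [program])
      (l.map Γ'.bit ++ w) s
    have h := (h₁.trans h₂).trans (ih (some b) _)
    have hlast : (b :: l).getLast?.or last = l.getLast?.or (some b) := by
      rw [List.getLast?_cons]
      cases l.getLast? <;> rfl
    rw [hlast]
    convert h.mono (t' := 2 * (b :: l).length) (by simp; omega) using 3
    · simp only [List.length_cons]; ring
    · simp only [bitsVal]; ring

/-- The program correctly reads a number, if there is one with the desired properties, and otherwise
rejects the input, except that it proceeds to the final test if the input ends where the next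
machine might begin. -/
theorem decides_start (r : Role C) (w : List Γ') (s : Regs ℓ) {τ : ℕ} {Φ : ℕ → List Γ' → Prop}
    {Φ₀ : Prop}
    (h : ∀ n w' u, w = numCons n w' → (mustPos uni r = true → 0 < n) →
      Decides uni τ (conf (.stored r) w' { s with acc := n * initialUnit s r, unit := u }) (Φ n w'))
    (h₀ : w = [] → r = .snum → ∀ u,
      Decides uni τ (conf .final [] { s with acc := 0, unit := u }) Φ₀) :
    Decides uni (τ + 2 * w.length + 2) (conf (.start r) w s)
      ((∃ n w', w = numCons n w' ∧ (mustPos uni r = true → 0 < n) ∧ Φ n w') ∨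
        (w = [] ∧ r = .snum ∧ Φ₀)) := by
  obtain ⟨l, w₁, hw, hw₁⟩ := exists_bits_append w
  have hstart := reaches_set (uni := uni) (q := .start r) (by rw [program]) w s
  have hdig := reaches_digits (uni := uni) r l none w₁
    { s with acc := 0, unit := initialUnit s r }
  rw [← hw] at hdig
  have hrun := hstart.trans hdig
  rw [Option.or_none, zero_add] at hrun
  set s₁ : Regs ℓ := { s with
    acc := bitsVal l * initialUnit s r, unit := 2 ^ l.length * initialUnit s r } with hs₁
  have hlen : w.length = l.length + w₁.length := by simp [hw]
  cases w₁ with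
  | nil =>
    rw [List.append_nil] at hw
    have hno : ∀ n w', w ≠ numCons n w' := by
      intro n w' h'
      have : Γ'.comma ∈ w := by rw [h']; simp [numCons]
      rw [hw] at this
      simp at this
    by_cases hr : r = .snum ∧ l.getLast? = none
    · have hl : l = [] := List.getLast?_eq_none_iff.1 hr.2
      have hstep : Reaches uni 1 (conf (.digit r l.getLast?) [] s₁) (conf .final [] s₁) := by
        refine Reaches.single ?_
        simp only [progStep, conf, program, List.head?_nil, List.tail_nil]
        rw [if_pos hr]
      have hd := h₀ (by simp [hw, hl]) hr.1 s₁.unit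
      have hacc : s₁ = { s with acc := 0, unit := s₁.unit } := by
        simp [hs₁, hl, bitsVal]
      rw [← hacc] at hd
      refine (((hrun.trans hstep).decides hd).mono (by omega)).congr ?_
      constructor
      · exact fun hp => Or.inr ⟨by simp [hw, hl], hr.1, hp⟩
      · rintro (⟨n, w', h', -⟩ | h')
        · exact absurd h' (hno n w')
        · exact h'.2.2
    · have hstep : Reaches uni 1 (conf (.digit r l.getLast?) [] s₁) (conf (.halt false) [] s₁) := by
        refine Reaches.single ?_
        simp only [progStep, conf, program, List.head?_nil, List.tail_nil]
        rw [if_neg hr]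
      refine ((hrun.trans hstep).decides (decides_halt ?_)).mono (by omega)
      simp only [Bool.false_eq_true, false_iff]
      rintro (⟨n, w', h', -⟩ | ⟨h', hr', -⟩)
      · exact hno n w' h'
      · refine hr ⟨hr', ?_⟩
        rw [hw, List.map_eq_nil_iff] at h'
        rw [h']
        rfl
  | cons x w₁ =>
    have hx : ∀ b, x ≠ .bit b := hw₁ x rfl
    have hne : w ≠ [] := by simp [hw]
    have hlen' : w.length = l.length + (w₁.length + 1) := hlen
    by_cases hc : x = .comma
    · subst hc
      have huniq : ∀ n w', w = numCons n w' → l = encodeNat n ∧ w₁ = w' := by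
        intro n w' h'
        rw [hw, numCons] at h'
        obtain ⟨h₁, -, h₂⟩ := bits_append_inj hx (by simp) h'
        exact ⟨h₁, h₂⟩
      by_cases hbad : l.getLast? = some false ∨ l.getLast? = none ∧ mustPos uni r = true
      · have hstep : Reaches uni 1 (conf (.digit r l.getLast?) (.comma :: w₁) s₁)
            (conf (.halt false) w₁ s₁) := by
          refine Reaches.single ?_
          simp only [progStep, conf, program, List.head?_cons, List.tail_cons]
          rw [if_pos hbad]
        refine ((hrun.trans hstep).decides (decides_halt ?_)).mono (by omega)
        simp only [Bool.false_eq_true, false_iff]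
        rintro (⟨n, w', h', hpos, -⟩ | ⟨h', -⟩)
        · obtain ⟨rfl, -⟩ := huniq n w' h'
          rcases hbad with hbad | ⟨hbad, hm⟩
          · exact getLast?_encodeNat n hbad
          · have hn := bitsVal_encodeNat n
            rw [List.getLast?_eq_none_iff.1 hbad] at hn
            exact (hpos hm).ne hn
        · exact hne h'
      · have hstep : Reaches uni 1 (conf (.digit r l.getLast?) (.comma :: w₁) s₁)
            (conf (.stored r) w₁ s₁) := by
          refine Reaches.single ?_
          simp only [progStep, conf, program, List.head?_cons, List.tail_cons]
          rw [if_neg hbad]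
        push Not at hbad
        have henc := encodeNat_bitsVal hbad.1
        have hw' : w = numCons (bitsVal l) w₁ := by rw [hw, numCons, henc]
        have hpos : mustPos uni r = true → 0 < bitsVal l := by
          intro hm
          by_contra h0
          rw [Nat.eq_zero_of_not_pos h0] at henc
          refine hbad.2 ?_ hm
          rw [← henc]
          rfl
        refine (((hrun.trans hstep).decides (h _ _ s₁.unit hw' hpos)).mono (by omega)).congr ?_
        constructor
        · exact fun hp => Or.inl ⟨_, _, hw', hpos, hp⟩
        · rintro (⟨n, w', h', -, hp⟩ | ⟨h', -⟩)
          · obtain ⟨rfl, rfl⟩ := numCons_inj (hw'.symm.trans h')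
            exact hp
          · exact absurd h' hne
    · have hstep : Reaches uni 1 (conf (.digit r l.getLast?) (x :: w₁) s₁)
          (conf (.halt false) w₁ s₁) := by
        refine Reaches.single ?_
        cases x with
        | bit b => exact absurd rfl (hx b)
        | comma => exact absurd rfl hc
        | _ => rfl
      refine ((hrun.trans hstep).decides (decides_halt ?_)).mono (by omega)
      simp only [Bool.false_eq_true, false_iff]
      rintro (⟨n, w', h', -⟩ | ⟨h', -⟩)
      · rw [hw, numCons] at h'
        exact hc (bits_append_inj hx (by simp) h').2.1
      · exact hne h'

/-! ### Division -/

/-- The loop `inner` doubles `unit` and `step = unit * divisor` as long as `step` still fits into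
the rest `prod - done`, so that at the end `2 * step` exceeds the rest. -/
theorem reaches_take (hℓ : ∀ j, 0 < ℓ j) (ρ : Kind ℓ) (w : List Γ') (j : ℕ) (s : Regs ℓ) (u : ℕ)
    (hu : 0 < u) (hle : s.done + u * s.divisor ≤ s.prod)
    (hlt : s.prod < s.done + 2 ^ j * (u * s.divisor)) :
    ∃ u', 0 < u' ∧ s.done + u' * s.divisor ≤ s.prod ∧ s.prod < s.done + 2 * (u' * s.divisor) ∧
      Reaches uni (2 * j + 1)
        (conf (.inner ρ (kind ℓ u)) w { s with step := u * s.divisor, unit := u })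
        (conf (.take ρ (kind ℓ u')) w { s with step := u' * s.divisor, unit := u' }) := by
  induction j generalizing u with
  | zero => rw [pow_zero, one_mul] at hlt; omega
  | succ j ih =>
    by_cases h : s.done + 2 * (u * s.divisor) ≤ s.prod
    · obtain ⟨u', hu', hle', hlt', hrun⟩ := ih (2 * u) (by omega) (by rwa [mul_assoc]) (by
        rwa [pow_succ, mul_assoc, ← mul_assoc 2 u] at hlt)
      refine ⟨u', hu', hle', hlt', ?_⟩
      have h₁ := reaches_test_true (uni := uni) (q := .inner ρ (kind ℓ u)) (by rw [program]) w
        (s := { s with step := u * s.divisor, unit := u }) h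
      have h₂ := reaches_set (uni := uni) (q := .double ρ (kind ℓ u)) (by rw [program]) w
        { s with step := u * s.divisor, unit := u }
      rw [kind_kind_add hℓ, ← two_mul] at h₂
      simp only [← mul_assoc] at h₂
      exact ((h₁.trans h₂).trans hrun).mono (by omega)
    · refine ⟨u, hu, hle, by omega, ?_⟩
      exact (reaches_test_false (by rw [program]) w h).mono (by omega)

/-- The loop `outer` adds the quotient of the rest `prod - done` by `divisor` to the total of the
deadlines and to the kind `n`. Each round at least halves the number that bounds the quotient, so
that `k` rounds suffice if the quotient is less than `2 ^ k`. -/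
theorem reaches_close (hℓ : ∀ j, 0 < ℓ j) (w : List Γ') (k : ℕ) (s : Regs ℓ) (n : ℕ)
    (hpos : 0 < s.divisor) (hle : s.done ≤ s.prod) (hlt : s.prod < s.done + 2 ^ k * s.divisor) :
    ∃ s' : Regs ℓ, s'.dnum = s.dnum ∧ s'.dden = s.dden ∧
      s'.sum = s.sum + vec 0 ((s.prod - s.done) / s.divisor) 0 ∧
      Reaches uni (k * (2 * k + 8) + 1) (conf (.outer (kind ℓ n)) w s)
        (conf (.close (kind ℓ (n + (s.prod - s.done) / s.divisor))) w s') := by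
  induction k generalizing s n with
  | zero =>
    rw [pow_zero, one_mul] at hlt
    have h0 : (s.prod - s.done) / s.divisor = 0 := Nat.div_eq_of_lt (by omega)
    refine ⟨s, rfl, rfl, by rw [h0, vec_zero, add_zero], ?_⟩
    rw [h0, add_zero]
    exact (reaches_test_false (by rw [program]) w (by omega)).mono (by omega)
  | succ k ih =>
    by_cases h : s.done + s.divisor ≤ s.prod
    · obtain ⟨u, hu, hle', hlt', hrun⟩ := reaches_take (uni := uni) hℓ (kind ℓ n) w (k + 1) s 1
        one_pos (by rwa [one_mul]) (by rwa [one_mul])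
      have h₁ := reaches_test_true (uni := uni) (q := .outer (kind ℓ n)) (by rw [program]) w h
      have h₂ := reaches_set (uni := uni) (q := .fresh (kind ℓ n)) (by rw [program]) w s
      have h₃ := reaches_set (uni := uni) (q := .take (kind ℓ n) (kind ℓ u)) (by rw [program]) w
        { s with step := u * s.divisor, unit := u }
      rw [one_mul] at hrun
      rw [kind_kind_add hℓ] at h₃
      obtain ⟨s', hs₁, hs₂, hs₃, hrun'⟩ := ih { s with
        done := s.done + u * s.divisor, step := u * s.divisor, unit := u,
        sum := s.sum + vec 0 u 0 } (n + u) hpos hle' (by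
          rw [pow_succ] at hlt
          dsimp only
          nlinarith)
      have hq : (s.prod - s.done) / s.divisor =
          u + (s.prod - (s.done + u * s.divisor)) / s.divisor := by
        have : s.prod - s.done = (s.prod - (s.done + u * s.divisor)) + s.divisor * u := by
          rw [mul_comm s.divisor]; omega
        rw [this, Nat.add_mul_div_left _ _ hpos, add_comm]
      refine ⟨s', hs₁, hs₂, ?_, ?_⟩
      · rw [hs₃, hq, add_assoc, vec_add]
        rfl
      · rw [hq, ← add_assoc]
        refine (((((h₁.trans h₂).trans hrun).trans h₃)).trans hrun').mono ?_
        nlinarith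
    · have h0 : (s.prod - s.done) / s.divisor = 0 := Nat.div_eq_of_lt (by omega)
      refine ⟨s, rfl, rfl, by rw [h0, vec_zero, add_zero], ?_⟩
      rw [h0, add_zero]
      exact (reaches_test_false (by rw [program]) w h).mono (by omega)

end Verification

section Correctness

variable {C : ℕ} {ℓ : Fin C → ℕ} {uni : Bool}

/-! ### The machines -/

/-- The deadline of a machine is computed and added to the description of the instance. -/
theorem reaches_next_machine (hℓ : ∀ j, 0 < ℓ j) (w : List Γ') (k : ℕ) (s : Regs ℓ)
    (hpos : 0 < s.divisor) (hdone : s.done = 0) (hlt : s.prod < 2 ^ k) :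
    ∃ s' : Regs ℓ, s'.dnum = s.dnum ∧ s'.dden = s.dden ∧
      s'.sum = s.sum +
        vec 0 (s.prod / s.divisor) (Pi.single (kind ℓ (s.prod / s.divisor)) 1) ∧
      Reaches uni (k * (2 * k + 8) + 2) (conf (.outer (kind ℓ 0)) w s)
        (conf (.start .snum) w s') := by
  have hlt' : s.prod < s.done + 2 ^ k * s.divisor := by
    have := Nat.le_mul_of_pos_right (2 ^ k) hpos
    omega
  obtain ⟨s', h₁, h₂, h₃, hrun⟩ := reaches_close (uni := uni) hℓ w k s 0 hpos (by omega) hlt'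
  rw [hdone, Nat.sub_zero, zero_add] at hrun
  rw [hdone, Nat.sub_zero] at h₃
  have hclose := reaches_set (uni := uni) (q := .close (kind ℓ (s.prod / s.divisor)))
    (by rw [program]) w s'
  refine ⟨{ s' with sum := s'.sum + vec 0 0 (Pi.single (kind ℓ (s.prod / s.divisor)) 1) },
    h₁, h₂, ?_, hrun.trans hclose⟩
  dsimp only
  rw [h₃, add_assoc, vec_add, zero_add, add_zero, zero_add]

/-- The numbers that describe a machine in the input. -/
def machineNumbers (uni : Bool) (x : ℕ × ℕ) : List ℕ := if uni then [x.1, x.2] else [x.1]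

/-- The condition on the numbers that describe a machine; a machine-dependent deadline is treated
like a numerator with denominator `1`. -/
def ValidMachine (uni : Bool) (x : ℕ × ℕ) : Prop :=
  0 < x.2 ∧ if uni then 0 < x.1 else x.2 = 1

variable (ℓ) in
/-- The word `w` lists machines which make up a schedulable instance together with the part of the
instance that is described by `v`, if the common deadline is `a / b`. -/
def MachinesSpec (uni : Bool) (a b : ℕ) (v : Coord ℓ → ℕ) (w : List Γ') : Prop :=
  ∃ M : List (ℕ × ℕ), (∀ x ∈ M, ValidMachine uni x) ∧
    w = encodeNumbers (M.flatMap (machineNumbers uni)) ∧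
    v + summary ℓ 0 (M.map fun x => x.1 * a / (x.2 * b)) ∈ schedulableMonoid ℓ

theorem machinesSpec_nil (a b : ℕ) (v : Coord ℓ → ℕ) :
    MachinesSpec ℓ uni a b v [] ↔ v ∈ schedulableMonoid ℓ := by
  constructor
  · rintro ⟨M, -, hw, hv⟩
    cases M with
    | nil => simpa [summary, vec_zero] using hv
    | cons x M =>
      cases uni <;> simp only [List.flatMap_cons, machineNumbers, Bool.false_eq_true, if_true,
        if_false, List.cons_append, encodeNumbers_cons] at hw <;>
      exact absurd hw.symm (numCons_ne_nil _ _)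
  · exact fun h => ⟨[], by simp, rfl, by simpa [summary, vec_zero] using h⟩

theorem machinesSpec_cons (a b : ℕ) (v : Coord ℓ → ℕ) (w : List Γ') (x : ℕ × ℕ)
    (hx : ValidMachine uni x) :
    MachinesSpec ℓ uni a b (v + vec 0 (x.1 * a / (x.2 * b))
      (Pi.single (kind ℓ (x.1 * a / (x.2 * b))) 1)) w →
    ∀ w', w' = (if uni then numCons x.1 (numCons x.2 w) else numCons x.1 w) →
      MachinesSpec ℓ uni a b v w' := by
  rintro ⟨M, hM, rfl, hv⟩ w' rfl
  refine ⟨x :: M, by simpa using ⟨hx, fun a b => hM (a, b)⟩, ?_, ?_⟩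
  · cases uni <;> simp [machineNumbers, encodeNumbers_cons]
  · rwa [List.map_cons, summary, ← add_assoc]

theorem machinesSpec_uniform (a b : ℕ) (v : Coord ℓ → ℕ) {w : List Γ'} (hw : w ≠ []) :
    MachinesSpec ℓ true a b v w ↔ ∃ p w₁, w = numCons p w₁ ∧ 0 < p ∧
      ∃ q w₂, w₁ = numCons q w₂ ∧ 0 < q ∧
        MachinesSpec ℓ true a b (v + vec 0 (p * a / (q * b))
          (Pi.single (kind ℓ (p * a / (q * b))) 1)) w₂ := by
  constructor
  · rintro ⟨M, hM, rfl, hv⟩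
    cases M with
    | nil => exact absurd rfl hw
    | cons x M =>
      obtain ⟨h₁, h₂⟩ := hM x List.mem_cons_self
      refine ⟨x.1, numCons x.2 (encodeNumbers (M.flatMap (machineNumbers true))), ?_, h₂, x.2, _,
        rfl, h₁, M, fun y hy => hM y (List.mem_cons_of_mem _ hy), rfl, ?_⟩
      · simp [machineNumbers, encodeNumbers_cons]
      · rwa [List.map_cons, summary, ← add_assoc] at hv
  · rintro ⟨p, w₁, rfl, hp, q, w₂, rfl, hq, h⟩
    exact machinesSpec_cons (uni := true) a b v w₂ (p, q) ⟨hq, hp⟩ h _ rfl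

theorem machinesSpec_deadlines (a b : ℕ) (v : Coord ℓ → ℕ) {w : List Γ'} (hw : w ≠ []) :
    MachinesSpec ℓ false a b v w ↔ ∃ p w₁, w = numCons p w₁ ∧
      MachinesSpec ℓ false a b (v + vec 0 (p * a / b) (Pi.single (kind ℓ (p * a / b)) 1)) w₁ := by
  constructor
  · rintro ⟨M, hM, rfl, hv⟩
    cases M with
    | nil => exact absurd rfl hw
    | cons x M =>
      obtain ⟨h₁, h₂⟩ := hM x List.mem_cons_self
      have h₂ : x.2 = 1 := h₂
      refine ⟨x.1, encodeNumbers (M.flatMap (machineNumbers false)), ?_, M,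
        fun y hy => hM y (List.mem_cons_of_mem _ hy), rfl, ?_⟩
      · simp [machineNumbers, encodeNumbers_cons]
      · rwa [List.map_cons, summary, ← add_assoc, h₂, one_mul] at hv
  · rintro ⟨p, w₁, rfl, h⟩
    exact machinesSpec_cons (uni := false) a b v w₁ (p, 1) ⟨one_pos, rfl⟩ (by simpa using h) _ rfl

theorem decides_final (s : Regs ℓ) :
    Decides uni 1 (conf .final [] s) (s.sum ∈ schedulableMonoid ℓ) := by
  by_cases h : s.sum ∈ schedulableMonoid ℓ
  · exact (reaches_test_true (by rw [program]) [] h).decides (decides_halt (by simp [h]))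
  · exact (reaches_test_false (by rw [program]) [] h).decides (decides_halt (by simp [h]))

/-- A bound on the time that the program takes for one machine, on inputs of length `n`. -/
def machineTime (n : ℕ) : ℕ := 8 * n ^ 2 + 20 * n + 8

theorem mul_lt_two_pow {p a n : ℕ} (hp : p < 2 ^ n) (ha : a < 2 ^ n) : p * a < 2 ^ (2 * n) := by
  rw [two_mul, pow_add]
  exact Nat.mul_lt_mul'' hp ha

/-- From the beginning of a machine on, the program correctly decides whether the remaining word
completes the instance to a schedulable one. -/
theorem decides_machines (hℓ : ∀ j, 0 < ℓ j) (n : ℕ) (w : List Γ') (hw : w.length ≤ n)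
    (s : Regs ℓ) (ha : s.dnum < 2 ^ n) (hb : 0 < s.dden) :
    Decides uni (w.length * machineTime n + 4) (conf (.start .snum) w s)
      (MachinesSpec ℓ uni s.dnum s.dden s.sum w) := by
  induction hm : w.length using Nat.strong_induction_on generalizing w s with
  | _ m ih =>
  subst hm
  by_cases hnil : w = []
  · subst hnil
    refine ((decides_start .snum [] s (τ := 1) (Φ := fun _ _ => False)
      (Φ₀ := s.sum ∈ schedulableMonoid ℓ)
      (fun n w' u h => absurd h.symm (numCons_ne_nil _ _))
      (fun _ _ u => decides_final { s with acc := 0, unit := u })).mono (by simp)).congr ?_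
    rw [machinesSpec_nil]
    simp
  -- the time after the numbers of the first machine have been read
  set τ := 2 * n * (2 * (2 * n) + 8) + 2 + ((w.length - 1) * machineTime n + 4) with hτ
  have hstep : ∀ (w' : List Γ') (s' : Regs ℓ), w'.length < w.length → s'.dnum = s.dnum →
      s'.dden = s.dden → 0 < s'.divisor → s'.done = 0 → s'.prod < 2 ^ (2 * n) →
      s'.sum = s.sum → Decides uni τ (conf (.outer (kind ℓ 0)) w' s')
        (MachinesSpec ℓ uni s.dnum s.dden (s.sum + vec 0 (s'.prod / s'.divisor)
          (Pi.single (kind ℓ (s'.prod / s'.divisor)) 1)) w') := by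
    intro w' s' hw' h₁ h₂ h₃ h₄ h₅ h₆
    obtain ⟨s'', g₁, g₂, g₃, hrun⟩ := reaches_next_machine (uni := uni) hℓ w' (2 * n) s' h₃ h₄ h₅
    have hd := ih w'.length hw' w' (hw'.le.trans hw) s'' (by rwa [g₁, h₁]) (by rwa [g₂, h₂]) rfl
    rw [g₁, g₂, g₃, h₁, h₂, h₆] at hd
    refine (hrun.decides hd).mono ?_
    have : w'.length * machineTime n ≤ (w.length - 1) * machineTime n :=
      Nat.mul_le_mul_right _ (by omega)
    omega
  have htime : (1 + (1 + τ + 2 * n + 2)) + 2 * w.length + 2 ≤ w.length * machineTime n + 4 := by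
    obtain ⟨k, hk⟩ : ∃ k, w.length = k + 1 :=
      Nat.exists_eq_succ_of_ne_zero (by simpa using hnil)
    rw [hτ, hk, Nat.add_sub_cancel, add_mul, one_mul]
    rw [hk] at hw
    generalize k * machineTime n = T
    rw [machineTime]
    nlinarith
  have hpow : ∀ p w', w = numCons p w' → p < 2 ^ n := fun p w' h =>
    (lt_two_pow_length_numCons p w').trans_le
      (Nat.pow_le_pow_right two_pos (by rwa [← h]))
  cases uni with
  | false =>
    refine ((decides_start (uni := false) .snum w s (τ := 1 + τ)
      (Φ := fun p w' => MachinesSpec ℓ false s.dnum s.dden (s.sum + vec 0 (p * s.dnum / s.dden)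
        (Pi.single (kind ℓ (p * s.dnum / s.dden)) 1)) w')
      (Φ₀ := False) (fun p w' u h _ => ?_) (fun h => absurd h hnil)).mono (by omega)).congr ?_
    · refine (reaches_set (by rw [program]) w' _).decides ?_
      exact hstep w' _ (h ▸ length_lt_length_numCons p w') rfl rfl hb rfl
        (mul_lt_two_pow (hpow p w' h) ha) rfl
    · rw [machinesSpec_deadlines _ _ _ hnil]
      simp [hnil, mustPos]
  | true =>
    refine ((decides_start (uni := true) .snum w s (τ := 1 + (1 + τ + 2 * n + 2))
      (Φ := fun p w' => ∃ q w₂, w' = numCons q w₂ ∧ 0 < q ∧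
        MachinesSpec ℓ true s.dnum s.dden (s.sum + vec 0 (p * s.dnum / (q * s.dden))
          (Pi.single (kind ℓ (p * s.dnum / (q * s.dden))) 1)) w₂)
      (Φ₀ := False) (fun p w' u h _ => ?_) (fun h => absurd h hnil)).mono htime).congr ?_
    · refine (reaches_set (by rw [program]) w' _).decides ?_
      have hlen := length_lt_length_numCons p w'
      rw [← h] at hlen
      refine ((decides_start (uni := true) .sden w' _ (τ := 1 + τ)
        (Φ := fun q w₂ => MachinesSpec ℓ true s.dnum s.dden
          (s.sum + vec 0 (p * s.dnum / (q * s.dden))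
            (Pi.single (kind ℓ (p * s.dnum / (q * s.dden))) 1)) w₂)
        (Φ₀ := False) (fun q w₂ u' h' hq => ?_) (fun _ h => nomatch h)).mono (by omega)).congr ?_
      · refine (reaches_set (by rw [program]) w₂ _).decides ?_
        have hlen' := length_lt_length_numCons q w₂
        rw [← h'] at hlen'
        exact hstep w₂ _ (hlen'.trans hlen) rfl rfl (Nat.mul_pos (hq rfl) hb) rfl
          (mul_lt_two_pow (hpow p w' h) ha) rfl
      · simp [mustPos]
    · rw [machinesSpec_uniform _ _ _ hnil]
      simp [hnil, mustPos]

end Correctness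

section Instances

variable {C : ℕ} {ℓ : Fin C → ℕ} {uni : Bool}

/-! ### The job counts and the common deadline -/

variable (ℓ) in
/-- The word `w` consists of the common deadline (for uniform machines) and a list of machines which
make up a schedulable instance together with the part of the instance that is described by `v`. -/
def DeadlineSpec (uni : Bool) (v : Coord ℓ → ℕ) (w : List Γ') : Prop :=
  if uni then ∃ a w₁, w = numCons a w₁ ∧ ∃ b w₂, w₁ = numCons b w₂ ∧ 0 < b ∧
    MachinesSpec ℓ true a b v w₂
  else MachinesSpec ℓ false 1 1 v w

/-- A bound on the time that the program takes after the job counts have been read, on inputs of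
length less than `n`. -/
def deadlineTime (n : ℕ) : ℕ := n * machineTime n + 4 * n + 10

/-- From the end of the job counts on, the program reads the deadline and the machines correctly. -/
theorem decides_deadline (hℓ : ∀ j, 0 < ℓ j) (n : ℕ) (w : List Γ') (hw : w.length < n) (s : Regs ℓ)
    (ha : s.dnum = 1) (hb : s.dden = 1) :
    Decides uni (deadlineTime n) (conf (.start (if uni then .dnum else .snum)) w s)
      (DeadlineSpec ℓ uni s.sum w) := by
  have htime : ∀ m < n, m * machineTime n ≤ n * machineTime n := fun m hm =>
    Nat.mul_le_mul_right _ hm.le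
  unfold deadlineTime
  cases uni with
  | false =>
    have h := decides_machines (uni := false) hℓ n w hw.le s
      (by rw [ha]; exact Nat.one_lt_two_pow (by omega)) (by omega)
    rw [ha, hb] at h
    exact h.mono (by have := htime _ hw; omega)
  | true =>
    set τ := n * machineTime n + 4 with hτ
    refine ((decides_start (uni := true) .dnum w s (τ := 1 + (1 + τ + 2 * n + 2))
      (Φ := fun a w₁ => ∃ b w₂, w₁ = numCons b w₂ ∧ 0 < b ∧ MachinesSpec ℓ true a b s.sum w₂)
      (Φ₀ := False) (fun a w₁ u h _ => ?_) (fun _ h => nomatch h)).mono (by omega)).congr ?_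
    · refine (reaches_set (by rw [program]) w₁ _).decides ?_
      have hlen := length_lt_length_numCons a w₁
      rw [← h] at hlen
      refine ((decides_start (uni := true) .dden w₁ _ (τ := 1 + τ)
        (Φ := fun b w₂ => MachinesSpec ℓ true a b s.sum w₂)
        (Φ₀ := False) (fun b w₂ u' h' hpos => ?_) (fun _ h => nomatch h)).mono (by omega)).congr ?_
      · refine (reaches_set (by rw [program]) w₂ _).decides ?_
        have hlen' := length_lt_length_numCons b w₂
        rw [← h'] at hlen'
        have hd := decides_machines (uni := true) hℓ n w₂ (by omega)
          { s with dnum := a * 1, dden := b * 1, acc := b * 1, unit := u' }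
          (by
            have := lt_two_pow_length_numCons a w₁
            rw [← h] at this
            dsimp only
            rw [mul_one]
            exact this.trans_le (Nat.pow_le_pow_right two_pos hw.le))
          (by simpa using hpos rfl)
        simp only [mul_one] at hd
        simp only [initialUnit, mul_one]
        exact hd.mono (by have := htime w₂.length (by omega); omega)
      · simp [mustPos]
    · simp [mustPos, DeadlineSpec]

/-- After `k` of the job counts, which have been stored in `n`, the program correctly reads the
other `d` job counts and the rest of the instance. -/
theorem decides_counts (hℓ : ∀ j, 0 < ℓ j) (N : ℕ) (d k : ℕ) (hk : k + d = C) (w : List Γ')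
    (hw : w.length < N) (s : Regs ℓ) (ha : s.dnum = 1) (hb : s.dden = 1) (n : Fin C → ℕ)
    (hs : s.sum = vec n 0 0) (hn : ∀ i : Fin C, k ≤ i → n i = 0) :
    Decides uni (d * (2 * N + 3) + deadlineTime N) (conf (.start (countRole uni k)) w s)
      (∃ n' : Fin C → ℕ, (∀ i : Fin C, i < k → n' i = n i) ∧ ∃ w',
        w = encodeNumbers ((List.ofFn n').drop k) ++ w' ∧ DeadlineSpec ℓ uni (vec n' 0 0) w') := by
  induction d generalizing k w s n with
  | zero =>
    have hr : countRole (C := C) uni k = if uni then .dnum else .snum := by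
      rw [countRole, dif_neg (by omega)]
    rw [hr, zero_mul, zero_add]
    refine (decides_deadline hℓ N w hw s ha hb).congr ?_
    have hdrop : ∀ n' : Fin C → ℕ, (List.ofFn n').drop k = [] := fun n' => by simp; omega
    simp only [hdrop, encodeNumbers_nil, List.nil_append, hs]
    constructor
    · exact fun h => ⟨n, fun _ _ => rfl, w, rfl, h⟩
    · rintro ⟨n', hn', w', rfl, h⟩
      rwa [funext fun i => hn' i (by omega)] at h
  | succ d ih =>
    have hkC : k < C := by omega
    have hr : countRole (C := C) uni k = .count ⟨k, hkC⟩ := by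
      rw [countRole, dif_pos hkC]
    have hdrop : ∀ n' : Fin C → ℕ,
        (List.ofFn n').drop k = n' ⟨k, hkC⟩ :: (List.ofFn n').drop (k + 1) := fun n' => by
      rw [List.drop_eq_getElem_cons (by simpa using hkC)]
      simp
    rw [hr]
    set n₁ : ℕ → Fin C → ℕ := fun p => n + fun i => if i = ⟨k, hkC⟩ then p else 0 with hn₁
    refine ((decides_start (uni := uni) (.count ⟨k, hkC⟩) w s
      (τ := 1 + (d * (2 * N + 3) + deadlineTime N))
      (Φ := fun p w₁ => ∃ n' : Fin C → ℕ, (∀ i : Fin C, i < k + 1 → n' i = n₁ p i) ∧ ∃ w',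
        w₁ = encodeNumbers ((List.ofFn n').drop (k + 1)) ++ w' ∧
          DeadlineSpec ℓ uni (vec n' 0 0) w')
      (Φ₀ := False) (fun p w₁ u h _ => ?_) (fun _ h => nomatch h)).mono ?_).congr ?_
    · refine (reaches_set (by rw [program]) w₁ _).decides ?_
      have hlen := length_lt_length_numCons p w₁
      rw [← h] at hlen
      set s' : Regs ℓ := { s with
        sum := s.sum +
          vec (fun i => if i = ⟨k, hkC⟩ then p * initialUnit s (.count ⟨k, hkC⟩) else 0) 0 0
        acc := p * initialUnit s (.count ⟨k, hkC⟩)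
        unit := u } with hs'
      refine ih (k + 1) (by omega) w₁ (by omega) s' ha hb (n₁ p) ?_ ?_
      · rw [hs', hs, vec_add, initialUnit, mul_one]
        rfl
      · intro i hi
        have hne : i ≠ ⟨k, hkC⟩ := fun h => by rw [h] at hi; simp at hi
        simp [hn₁, hn i (by omega), hne]
    · have : (d + 1) * (2 * N + 3) = d * (2 * N + 3) + (2 * N + 3) := by ring
      omega
    · have hn₁k : ∀ p, n₁ p ⟨k, hkC⟩ = p := fun p => by simp [hn₁, hn ⟨k, hkC⟩ le_rfl]
      have hn₁i : ∀ p (i : Fin C), i < k → n₁ p i = n i := fun p i hi => by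
        have hne : i ≠ ⟨k, hkC⟩ := fun h => by rw [h] at hi; simp at hi
        simp [hn₁, hne]
      constructor
      · rintro (⟨p, w₁, rfl, -, n', hn', w', rfl, h⟩ | ⟨-, h, -⟩)
        · refine ⟨n', fun i hi => (hn' i (by omega)).trans (hn₁i p i hi), w', ?_, h⟩
          rw [hdrop, encodeNumbers_cons, numCons_append, hn' ⟨k, hkC⟩ (by simp), hn₁k]
        · cases h
      · rintro ⟨n', hn', w', rfl, h⟩
        refine Or.inl ⟨n' ⟨k, hkC⟩, _, by rw [hdrop, encodeNumbers_cons, numCons_append],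
          by simp [mustPos], n', fun i hi => ?_, w', rfl, h⟩
        rcases Nat.lt_succ_iff_lt_or_eq.1 hi with hi | hi
        · rw [hn₁i _ _ hi, hn' i hi]
        · obtain rfl : i = ⟨k, hkC⟩ := Fin.ext hi
          rw [hn₁k]

variable (ℓ) in
/-- The word `w` consists of job counts, the common deadline (for uniform machines) and machines
which make up a schedulable instance. -/
def InstanceSpec (uni : Bool) (w : List Γ') : Prop :=
  ∃ (n : Fin C → ℕ) (w' : List Γ'), w = encodeNumbers (List.ofFn n) ++ w' ∧
    DeadlineSpec ℓ uni (vec n 0 0) w'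

theorem program_decides (hℓ : ∀ j, 0 < ℓ j) (w : List Γ') :
    Decides uni (C * (2 * (w.length + 1) + 3) + deadlineTime (w.length + 1) + 1)
      (⟨.init, w, 0⟩ : Conf (Ctl ℓ) (Reg ℓ → ℕ)) (InstanceSpec ℓ uni w) := by
  have hzero : (⟨.init, w, 0⟩ : Conf (Ctl ℓ) (Reg ℓ → ℕ)) =
      conf .init w ⟨0, 0, 0, 0, 0, 0, 0, 0, 0⟩ := by
    unfold conf
    congr 1
    funext i
    rcases i with _ | _ | _ | _ | _ | _ | _ | _ | _ <;> rfl
  rw [hzero]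
  have h := decides_counts (uni := uni) hℓ (w.length + 1) C 0 (by omega) w (by omega)
    ⟨0, 1, 1, 0, 0, 0, 0, 0, 0⟩ rfl rfl 0 vec_zero.symm fun _ _ => rfl
  refine (((reaches_set (by rw [program]) w _).decides h).mono (by omega)).congr ?_
  simp [InstanceSpec]

/-- Both scheduling problems, as far as they are described by `InstanceSpec`, are in `P`. -/
theorem inP_instanceSpec (hℓ : ∀ j, 0 < ℓ j) (uni : Bool) (L : Language Γ')
    (hL : ∀ w, w ∈ L ↔ InstanceSpec ℓ uni w) : InP L := by
  have := Fintype.ofFinite (Ctl ℓ)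
  refine inP_of_program (program ℓ uni) (program_realizable hℓ uni) .init L
    (Polynomial.C C * (2 * (Polynomial.X + 1) + 3) + ((Polynomial.X + 1) *
      (8 * (Polynomial.X + 1) ^ 2 + 20 * (Polynomial.X + 1) + 8) + 4 * (Polynomial.X + 1) + 10) +
      1) fun w => ?_
  obtain ⟨k, hk, b, hb, h⟩ := program_decides (uni := uni) hℓ w
  refine ⟨k, ?_, b, hb.trans (hL w).symm, h⟩
  simpa [deadlineTime, machineTime] using hk

/-! ### The two scheduling problems -/

theorem fits_iff_add_summary_mem (hℓ : ∀ j, 0 < ℓ j) (n : Fin C → ℕ) (Ds : List ℕ) :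
    Fits ℓ Ds n ↔ vec n 0 0 + summary ℓ 0 Ds ∈ schedulableMonoid ℓ := by
  rw [← summary_add, add_zero]
  exact fits_iff_summary_mem hℓ Ds n

theorem ofFn_comp_get {α β : Type*} (M : List α) (f : α → β) :
    (List.ofFn fun i => f (M.get i)) = M.map f := by
  rw [← List.ofFn_get M, List.map_ofFn]
  simp [Function.comp_def]

theorem flatMap_machineNumbers_false (M : List (ℕ × ℕ)) :
    M.flatMap (machineNumbers false) = M.map Prod.fst :=
  (List.map_eq_flatMap ..).symm

theorem mem_deadlineScheduling_iff (hℓ : ∀ j, 0 < ℓ j) (w : List Γ') :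
    w ∈ deadlineScheduling ℓ ↔ InstanceSpec ℓ false w := by
  constructor
  · rintro ⟨⟨n, m, D⟩, rfl, h⟩
    refine ⟨n, _, encodeNumbers_append _ _, ?_⟩
    refine ⟨(List.ofFn D).map fun d => (d, 1), ?_, ?_, ?_⟩
    · simp [ValidMachine]
    · rw [flatMap_machineNumbers_false, List.map_map]
      exact congrArg encodeNumbers (List.map_id _).symm
    · rw [← fits_iff_add_summary_mem hℓ]
      have := (exists_assignment_iff_fits D n).1 h
      simpa [Function.comp_def] using this
  · rintro ⟨n, w', rfl, M, hM, rfl, h⟩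
    refine ⟨⟨n, M.length, fun i => (M.get i).1⟩, ?_, ?_⟩
    · refine (encodeNumbers_append _ _).trans
        (congrArg (encodeNumbers (List.ofFn n) ++ encodeNumbers ·) ?_)
      rw [flatMap_machineNumbers_false]
      exact ofFn_comp_get M Prod.fst
    · refine (exists_assignment_iff_fits _ n).2 ?_
      rw [fits_iff_add_summary_mem hℓ, ofFn_comp_get M Prod.fst]
      convert h using 3
      refine List.map_congr_left fun x hx => ?_
      rw [show x.2 = 1 from (hM x hx).2, mul_one, mul_one, Nat.div_one]

/-- A uniform machine has an integral deadline of its own: the product of speed and common deadline,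
rounded down. -/
theorem div_speed_le_iff {C : ℕ} (I : UniformInstance C) (i : Fin I.m) (x : ℕ) :
    (x : ℚ) / I.speed i ≤ I.deadline ↔
      x ≤ I.speedNum i * I.deadlineNum / (I.speedDen i * I.deadlineDen) := by
  have h₁ : (0 : ℚ) < I.speedNum i := Nat.cast_pos.2 (I.speedNum_pos i)
  have h₂ : (0 : ℚ) < I.speedDen i := Nat.cast_pos.2 (I.speedDen_pos i)
  have h₃ : (0 : ℚ) < I.deadlineDen := Nat.cast_pos.2 I.deadlineDen_pos
  rw [Nat.le_div_iff_mul_le (Nat.mul_pos (I.speedDen_pos i) I.deadlineDen_pos),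
    UniformInstance.speed, UniformInstance.deadline, div_le_iff₀ (div_pos h₁ h₂), div_mul_div_comm,
    le_div_iff₀ (mul_pos h₃ h₂), ← Nat.cast_le (α := ℚ)]
  push_cast
  rw [mul_comm (I.speedDen i : ℚ), mul_comm (I.speedNum i : ℚ)]

theorem mem_uniformScheduling_iff (hℓ : ∀ j, 0 < ℓ j) (w : List Γ') :
    w ∈ uniformScheduling ℓ ↔ InstanceSpec ℓ true w := by
  have hsched : ∀ I : UniformInstance C, I.Schedulable ℓ ↔ Fits ℓ (List.ofFn fun i =>
      I.speedNum i * I.deadlineNum / (I.speedDen i * I.deadlineDen)) I.count := fun I => by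
    rw [← exists_assignment_iff_fits]
    simp only [UniformInstance.Schedulable, div_speed_le_iff]
  constructor
  · rintro ⟨I, rfl, h⟩
    rw [hsched, fits_iff_add_summary_mem hℓ] at h
    refine ⟨I.count, _, (congrArg encodeNumbers (List.append_assoc _ _ _)).trans
      (encodeNumbers_append _ _), ?_⟩
    refine ⟨I.deadlineNum, _, encodeNumbers_cons _ _, I.deadlineDen, _, encodeNumbers_cons _ _,
      I.deadlineDen_pos, List.ofFn fun i => (I.speedNum i, I.speedDen i), ?_, ?_, ?_⟩
    · intro x hx
      obtain ⟨i, rfl⟩ := (List.mem_ofFn' _ _).1 hx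
      exact ⟨I.speedDen_pos i, I.speedNum_pos i⟩
    · rw [List.flatMap_def, List.map_ofFn]
      rfl
    · rwa [List.map_ofFn]
  · rintro ⟨n, w', rfl, a, w₁, rfl, b, w₂, rfl, hb, M, hM, rfl, h⟩
    refine ⟨⟨n, M.length, fun i => (M.get i).1, fun i => (M.get i).2,
      fun i => (hM _ (M.get_mem i)).2, fun i => (hM _ (M.get_mem i)).1, a, b, hb⟩, ?_, ?_⟩
    · refine (congrArg encodeNumbers (List.append_assoc _ _ _)).trans
        ((encodeNumbers_append _ _).trans (congrArg (_ ++ ·) ?_))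
      refine (encodeNumbers_cons _ _).trans (congrArg _ ((encodeNumbers_cons _ _).trans ?_))
      rw [ofFn_comp_get M fun x => [x.1, x.2], ← List.flatMap_def]
      rfl
    · rw [hsched, fits_iff_add_summary_mem hℓ]
      rwa [ofFn_comp_get M fun x => x.1 * a / (x.2 * b)]

end Instances

end HMScheduling

theorem theoremt (C : ℕ) (ℓ : Fin C → ℕ) (hℓ : ∀ j, 0 < ℓ j) :
    InP (HMScheduling.uniformScheduling ℓ) ∧ InP (HMScheduling.deadlineScheduling ℓ) :=
  ⟨HMScheduling.inP_instanceSpec hℓ true _ (HMScheduling.mem_uniformScheduling_iff hℓ),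
    HMScheduling.inP_instanceSpec hℓ false _ (HMScheduling.mem_deadlineScheduling_iff hℓ)⟩
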